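/- Let $M$ be a compact smooth manifold without boundary of dimension $n\ge 1$, and let $g_0,g_1$ be Riemannian metrics on $M$, smooth or more generally of class $C^r$ for some $r\ge 0$. Put $$\rho(g_0,g_1)=\sup_{x\in M}\ \sup_{0\ne\xi\in T_xM}\left|\ln\frac{g_1(\xi,\xi)}{g_0(\xi,\xi)}\right| .$$ For a metric $g$ let $d\mathrm{vol}(g)$ be its Riemannian volume measure, let $\mathrm{diam}(M,g)=\sup_{x,y\in M}\inf_\gamma L_g(\gamma)$ be its diameter, where $\gamma$ runs over the $C^1$ paths from $x$ to $y$ and $L_g(\gamma)$ is the $g$-length, and let $\lambda_0(g)\le\lambda_1(g)\le\lambda_2(g)\le\cdots$ be the eigenvalues, repeated according to multiplicity, of the (non-negative) Laplace operator of $g$ on $L^2(M,d\mathrm{vol}(g))$. Here $\lambda$ is an eigenvalue with eigenfunction $u\neq 0$ if $u\in H^1(M)$ and $\int_M\langle du,d\psi\rangle_{g^{-1}}\,d\mathrm{vol}(g)=\lambda\int_M u\,\psi\,d\mathrm{vol}(g)$ for all $\psi\in C^\infty(M)$. Suppose that $d\mathrm{vol}(g_0)=d\mathrm{vol}(g_1)$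 and $\rho(g_0,g_1)<R$. Then: 1. If $M$ is connected, then $$e^{-R}\le\frac{\mathrm{diam}(M,g_1)}{\mathrm{diam}(M,g_0)}\le e^{R}.$$ 2. For every $k\ge 0$, $$e^{-2R}\,\lambda_k(g_0)\le\lambda_k(g_1)\le e^{2R}\,\lambda_k(g_0).$$ If $M$ is connected, then for every $k\ge 1$ $$e^{-2R}\le\frac{\lambda_k(g_1)}{\lambda_k(g_0)}\le e^{2R}.$$ -/

import Mathlib

open MeasureTheory Filter Topology
open scoped Manifold ContDiff ENNReal Bundle

noncomputable section

namespace RandomMetrics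

variable {n : ℕ} {M : Type*} [TopologicalSpace M]
  [ChartedSpace (EuclideanSpace ℝ (Fin n)) M] [IsManifold (𝓡 n) ∞ M]

/-- Riemannian metrics of class `C^r` on the manifold `M` (`r = ∞`: smooth metrics). -/
abbrev Metric (n : ℕ) (r : WithTop ℕ∞) (M : Type*) [TopologicalSpace M]
    [ChartedSpace (EuclideanSpace ℝ (Fin n)) M] [IsManifold (𝓡 n) ∞ M] :=
  Bundle.ContMDiffRiemannianMetric (𝓡 n) r (EuclideanSpace ℝ (Fin n))
    (fun x : M ↦ TangentSpace (𝓡 n) x)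

variable {r : WithTop ℕ∞}

/-- The Lipschitz-type distance
`ρ(g₀, g₁) = sup_x sup_{0 ≠ ξ ∈ T_x M} |ln (g₁(ξ,ξ) / g₀(ξ,ξ))|`, as a number in `[0, ∞]`. -/
def rho (g₀ g₁ : Metric n r M) : ℝ≥0∞ :=
  ⨆ (x : M) (ξ : TangentSpace (𝓡 n) x) (_ : ξ ≠ 0),
    ENNReal.ofReal |Real.log (g₁.inner x ξ ξ / g₀.inner x ξ ξ)|

/-- The diameter: the supremum over `x, y` of the infimum of the `g`-lengths of the `C^1` paths
from `x` to `y`. -/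
def diam (g : Metric n r M) : ℝ :=
  letI : Bundle.RiemannianBundle (fun x : M ↦ TangentSpace (𝓡 n) x) := ⟨g.toRiemannianMetric⟩
  (⨆ (x : M) (y : M), Manifold.riemannianEDist (𝓡 n) x y).toReal

/-- The `i`-th coordinate vector field of the preferred chart at `x`, at the point with
coordinates `e`. -/
def coordVector (x : M) (e : EuclideanSpace ℝ (Fin n)) (i : Fin n) :
    TangentSpace (𝓡 n) ((extChartAt (𝓡 n) x).symm e) :=
  mfderiv 𝓘(ℝ, EuclideanSpace ℝ (Fin n)) (𝓡 n) (extChartAt (𝓡 n) x).symm e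
    (EuclideanSpace.single i (1 : ℝ) : EuclideanSpace ℝ (Fin n))

/-- The density `√det(g_ij)` of the Riemannian volume in the preferred chart at `x`. -/
def chartDensity (g : Metric n r M) (x : M) (e : EuclideanSpace ℝ (Fin n)) : ℝ :=
  √(Matrix.det (Matrix.of fun i j : Fin n ↦
    g.inner ((extChartAt (𝓡 n) x).symm e) (coordVector x e i) (coordVector x e j)))

/-- The Riemannian volume of the domain of the preferred chart at `x`, that is the measure
`√det(g_ij) de`, transported to `M`. -/
def chartVolume [MeasurableSpace M] (g : Metric n r M) (x : M) : Measure M :=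
  (((volume : Measure (EuclideanSpace ℝ (Fin n))).restrict
      (extChartAt (𝓡 n) x).target).withDensity
    (fun e ↦ ENNReal.ofReal (chartDensity g x e))).map (extChartAt (𝓡 n) x).symm

/-- The Riemannian volume measure `dvol(g)`. The measures `chartVolume g x` are the restrictions
of one measure to the chart domains, which cover `M`; their supremum in the lattice of measures
is that measure. -/
def vol [MeasurableSpace M] (g : Metric n r M) : Measure M :=
  ⨆ x : M, chartVolume g x

lemma flat_bijective (g : Metric n r M) (x : M) :
    Function.Bijective (g.inner x : TangentSpace (𝓡 n) x →ₗ[ℝ] (TangentSpace (𝓡 n) x →L[ℝ] ℝ)) := by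
  have hinj : Function.Injective
      (g.inner x : TangentSpace (𝓡 n) x →ₗ[ℝ] (TangentSpace (𝓡 n) x →L[ℝ] ℝ)) := by
    rw [← LinearMap.ker_eq_bot, LinearMap.ker_eq_bot']
    intro v hv
    by_contra hne
    have h := g.pos x v hne
    have h0 : g.inner x v = 0 := hv
    rw [h0] at h
    exact lt_irrefl _ h
  have hfin : FiniteDimensional ℝ (TangentSpace (𝓡 n) x) :=
    inferInstanceAs (FiniteDimensional ℝ (EuclideanSpace ℝ (Fin n)))
  have hT2 : T2Space (TangentSpace (𝓡 n) x) :=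
    inferInstanceAs (T2Space (EuclideanSpace ℝ (Fin n)))
  have e : (TangentSpace (𝓡 n) x →L[ℝ] ℝ) ≃ₗ[ℝ] Module.Dual ℝ (TangentSpace (𝓡 n) x) :=
    (LinearMap.toContinuousLinearMap (𝕜 := ℝ) (E := TangentSpace (𝓡 n) x) (F' := ℝ)).symm
  have hfin' : FiniteDimensional ℝ (TangentSpace (𝓡 n) x →L[ℝ] ℝ) := e.symm.finiteDimensional
  have hrank : Module.finrank ℝ (TangentSpace (𝓡 n) x) =
      Module.finrank ℝ (TangentSpace (𝓡 n) x →L[ℝ] ℝ) := by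
    rw [e.finrank_eq, Subspace.dual_finrank_eq]
  exact ⟨hinj, (LinearMap.injective_iff_surjective_of_finrank_eq_finrank hrank).1 hinj⟩

/-- The musical isomorphism `v ↦ g(v, ·)` from the tangent to the cotangent space at `x`. -/
def flat (g : Metric n r M) (x : M) :
    TangentSpace (𝓡 n) x ≃ₗ[ℝ] (TangentSpace (𝓡 n) x →L[ℝ] ℝ) :=
  LinearEquiv.ofBijective (g.inner x : TangentSpace (𝓡 n) x →ₗ[ℝ] _) (flat_bijective g x)

/-- The inner product `⟨α, β⟩_{g⁻¹}` of two covectors at `x`. -/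
def cometric (g : Metric n r M) (x : M) (α β : TangentSpace (𝓡 n) x →L[ℝ] ℝ) : ℝ :=
  g.inner x ((flat g x).symm α) ((flat g x).symm β)

/-- The Dirichlet form `∫_M ⟨dφ, dψ⟩_{g⁻¹} dvol(g)`. -/
def dirichlet [MeasurableSpace M] (g : Metric n r M) (φ ψ : C^∞⟮𝓡 n, M; ℝ⟯) : ℝ :=
  ∫ x, cometric g x (mfderiv (𝓡 n) 𝓘(ℝ, ℝ) φ x) (mfderiv (𝓡 n) 𝓘(ℝ, ℝ) ψ x) ∂(vol g)

/-- `u ∈ L²(M)` lies in `H¹(M)` and is a weak solution of `-Δ_g u = μ u`. Here `H¹(M)` is the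
closure of `C^∞(M)` in the norm `(‖φ‖² + ‖dφ‖²)^{1/2}`: `u` is the `L²`-limit of smooth functions
`φ_j` which are Cauchy in energy, and then `⟨du, dψ⟩ = lim_j ⟨dφ_j, dψ⟩`. -/
def IsWeakEigenfunction [MeasurableSpace M] (g : Metric n r M) (μ : ℝ)
    (u : Lp ℝ 2 (vol g)) : Prop :=
  ∃ φ : ℕ → C^∞⟮𝓡 n, M; ℝ⟯,
    Tendsto (fun j ↦ eLpNorm (fun x ↦ u x - φ j x) 2 (vol g)) atTop (𝓝 0) ∧
    Tendsto (fun p : ℕ × ℕ ↦ dirichlet g (φ p.1 - φ p.2) (φ p.1 - φ p.2)) atTop (𝓝 0) ∧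
    ∀ ψ : C^∞⟮𝓡 n, M; ℝ⟯,
      Tendsto (fun j ↦ dirichlet g (φ j) ψ) atTop (𝓝 (μ * ∫ x, u x * ψ x ∂(vol g)))

/-- The `k`-th eigenvalue (`k = 0, 1, 2, …`) of the Laplace operator of `g`, the eigenvalues being
listed in non-decreasing order and repeated according to multiplicity: the least `t` for which
there are `k + 1` linearly independent eigenfunctions with eigenvalues at most `t`. -/
def eigenvalue [MeasurableSpace M] (g : Metric n r M) (k : ℕ) : ℝ :=
  sInf {t : ℝ | ∃ u : Fin (k + 1) → Lp ℝ 2 (vol g),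
    LinearIndependent ℝ u ∧ ∀ i, ∃ μ ≤ t, IsWeakEigenfunction g μ (u i)}

end RandomMetrics

end

/-! The bound on `rho` says that e^{-R} g₀ ≤ g₁ ≤ e^{R} g₀ as quadratic forms
(`pos_and_inner_le_of_rho_lt`). Lengths of paths, hence distances and the diameter, change by a
factor of at most e^{R/2} (`riemannianDist_le`, `diam_le`). Inverting the metrics gives the same
two-sided bound for the norms of covectors (`cometric_le_of_inner_le`). The volume measures
coincide, so the L² norms are equal and the Dirichlet integrals differ by a factor of at most e^{R}
(`dirichletForm_le`); by the min-max principle so do the eigenvalues (`eigenvalue_le`). The factors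
e^{R/2} and e^{R} are finally weakened to e^{R} and e^{2R}.

Most of the work is the min-max principle for `eigenvalue`, which is defined through weak
eigenfunctions. Let H be the completion of C^∞(M) in the energy norm and j : H → L² the natural map.
A weak eigenvalue μ corresponds to the eigenvalue 1/(1+μ) of j†j. Eigenfunctions with eigenvalues at
most t span a space of energy at most t (`hasEnergyBound_of_isFormEigenvector`); conversely a space
of energy at most t yields as many eigenfunctions (`HasEnergyBound.hasEigenvectors`). In between,
the low-energy space is carried from one form to the other (`HasEnergyBound.of_le`).

The converse needs j to be compact, which is Rellich's theorem (`isCompactForm_dirichletForm`). It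
comes from cutting M into small pieces that are convex in charts and applying the Poincaré
inequality to each: functions with zero mean on every piece have L² norm at most a small multiple of
their energy.

The quotients require nonzero denominators. On a connected M the local Poincaré inequalities glue to
a global one (`hasPoincare_univ`), so that λ_k > 0 for k ≥ 1 (`eigenvalue_pos`); the diameter is
positive and finite because the Riemannian distance induces the topology of a compact connected
space (`iSup_riemannianDist`). -/

noncomputable section

namespace RandomMetrics

/-! ### Compact operators and the Courant–Fischer principle for j†j. -/

section Spectral

open scoped InnerProductSpace

variable {E L : Type*} [NormedAddCommGroup E] [InnerProductSpace ℝ E] [NormedAddCommGroup L]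
  [InnerProductSpace ℝ L]

/-- An operator which is small on the orthogonal complements of finite dimensional subspaces is
compact. -/
lemma isCompactOperator_of_forall_small [CompleteSpace L] (j : E →L[ℝ] L)
    (h : ∀ ε > 0, ∃ F : Submodule ℝ E, FiniteDimensional ℝ F ∧
      ∀ x ∈ Fᗮ, ‖j x‖ ^ 2 ≤ ε * ‖x‖ ^ 2) : IsCompactOperator j := by
  have hcl : IsClosed {f : E →L[ℝ] L | IsCompactOperator f} :=
    isClosed_setOfPred_isCompactOperator
  change j ∈ {f : E →L[ℝ] L | IsCompactOperator f}
  rw [← hcl.closure_eq, Metric.mem_closure_iff]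
  intro δ hδ
  obtain ⟨F, hF, hs⟩ := h ((δ / 2) ^ 2) (by positivity)
  -- The finite-rank approximation of j; the error is j on the component in Fᗮ, of norm at most δ/2.
  refine ⟨j ∘L F.starProjection, ?_, ?_⟩
  · have h1 : IsCompactOperator (id : F → F) :=
      (isCompactOperator_id_iff_finiteDimensional (𝕜 := ℝ)).2 hF
    have h2 := (h1.comp_clm F.orthogonalProjectionOnto).clm_comp (j ∘L F.subtypeL)
    exact h2
  · rw [dist_eq_norm]
    refine lt_of_le_of_lt (ContinuousLinearMap.opNorm_le_bound _ (by positivity : 0 ≤ δ / 2) ?_)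
      (by linarith)
    intro x
    have h3 : (j - j ∘L F.starProjection) x = j (x - F.starProjection x) := by simp
    rw [h3]
    have h4 := hs _ (F.sub_starProjection_mem_orthogonal x)
    have h5 : ‖x - F.starProjection x‖ ≤ ‖x‖ := by
      rw [← F.starProjection_orthogonal_val]
      exact Submodule.norm_starProjection_apply_le Fᗮ x
    refine le_trans (abs_le_of_sq_le_sq' (b := δ / 2 * ‖x - F.starProjection x‖) ?_
      (by positivity)).2 (by gcongr)
    rw [mul_pow]; exact h4

/-- The top eigenvalue of `j† j` dominates every Rayleigh quotient `‖j h‖² / ‖h‖²`. -/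
lemma exists_eigenvector_ge [CompleteSpace E] [CompleteSpace L] {j : E →L[ℝ] L} (hj : IsCompactOperator j) {κ : ℝ} (hκ : 0 < κ)
    {h : E} (h0 : h ≠ 0) (hh : κ * ‖h‖ ^ 2 ≤ ‖j h‖ ^ 2) :
    ∃ κ' ≥ κ, ∃ h' : E, h' ≠ 0 ∧ ∀ x, ⟪j h', j x⟫_ℝ = κ' * ⟪h', x⟫_ℝ := by
  set T : E →L[ℝ] E := j.adjoint ∘L j with hT
  have hTin : ∀ x y, ⟪T x, y⟫_ℝ = ⟪j x, j y⟫_ℝ := fun x y ↦ by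
    simp [hT, ContinuousLinearMap.adjoint_inner_left]
  have hTc : IsCompactOperator T := hj.clm_comp j.adjoint
  have hTs : T.IsSymmetric := fun x y ↦ by
    change ⟪T x, y⟫_ℝ = ⟪x, T y⟫_ℝ
    rw [hTin, real_inner_comm (T y) x, hTin, real_inner_comm]
  have hnorm : κ ≤ ‖T‖ := by
    have h1 : ‖j h‖ ^ 2 ≤ ‖T‖ * ‖h‖ ^ 2 := by
      rw [← real_inner_self_eq_norm_sq, ← hTin]
      calc _ ≤ ‖T h‖ * ‖h‖ := real_inner_le_norm _ _
        _ ≤ ‖T‖ * ‖h‖ * ‖h‖ := by gcongr; exact T.le_opNorm h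
        _ = _ := by ring
    have h2 : 0 < ‖h‖ ^ 2 := by positivity
    exact le_of_mul_le_mul_right (hh.trans h1) h2
  have hEnt : Nontrivial E := ⟨h, 0, h0⟩
  have hr := T.spectralRadius_eq_nnnorm hTs.isSelfAdjoint
  -- An empty real spectrum would have spectral radius 0, while self-adjointness makes it ‖T‖ ≥ κ >
  -- 0.
  have hne : (spectrum ℝ T).Nonempty := by
    by_contra hemp
    rw [Set.not_nonempty_iff_eq_empty] at hemp
    rw [spectralRadius, hemp] at hr
    have : ‖T‖ = 0 := by simpa using hr.symm
    linarith
  obtain ⟨z, hz, hzr⟩ := spectrum.exists_nnnorm_eq_spectralRadius_of_nonempty hne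
  rw [hr] at hzr
  have hzn : ‖z‖ = ‖T‖ := by
    have : ‖z‖₊ = ‖T‖₊ := by exact_mod_cast hzr
    exact congrArg NNReal.toReal this
  have hz0 : z ≠ 0 := by
    intro h; rw [h, norm_zero] at hzn; linarith
  obtain ⟨h', hh'⟩ := ((hTc.hasEigenvalue_iff_mem_spectrum hz0).2 hz).exists_hasEigenvector
  have hev : T h' = z • h' := hh'.apply_eq_smul
  -- So far only |z| = ‖T‖ is known; positivity of j†j excludes z = -‖T‖.
  have hpos : 0 ≤ z := by
    have h1 : ⟪T h', h'⟫_ℝ = ‖j h'‖ ^ 2 := by rw [hTin, real_inner_self_eq_norm_sq]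
    rw [hev, real_inner_smul_left, real_inner_self_eq_norm_sq] at h1
    have h2 : 0 < ‖h'‖ ^ 2 := by have := hh'.2; positivity
    by_contra hneg
    nlinarith [sq_nonneg ‖j h'‖]
  refine ⟨z, ?_, h', hh'.2, fun x ↦ ?_⟩
  · rw [Real.norm_of_nonneg hpos] at hzn; linarith
  · rw [← hTin, hev, real_inner_smul_left]

/-- Courant–Fischer: if `‖j h‖² ≥ κ ‖h‖²` on an `m`-dimensional space, then `j† j` has `m`
orthogonal eigenvectors with eigenvalues at least `κ`. -/
lemma exists_eigenvector_family [CompleteSpace E] [CompleteSpace L]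
    {j : E →L[ℝ] L} (hj : IsCompactOperator j) {κ : ℝ} (hκ : 0 < κ)
    {U : Submodule ℝ E} (hU : ∀ h ∈ U, κ * ‖h‖ ^ 2 ≤ ‖j h‖ ^ 2) (m : ℕ)
    (hm : m ≤ Module.finrank ℝ U) :
    ∃ (h : Fin m → E) (κ' : Fin m → ℝ), (∀ i, κ ≤ κ' i) ∧ (∀ i, h i ≠ 0) ∧
      (∀ i l, i ≠ l → ⟪h i, h l⟫_ℝ = 0) ∧ ∀ i x, ⟪j (h i), j x⟫_ℝ = κ' i * ⟪h i, x⟫_ℝ := by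
  induction m with
  | zero => exact ⟨fun i ↦ i.elim0, fun i ↦ i.elim0, fun i ↦ i.elim0, fun i ↦ i.elim0,
      fun i ↦ i.elim0, fun i ↦ i.elim0⟩
  | succ m ih =>
    obtain ⟨h, κ', h1, h2, h3, h4⟩ := ih (by omega)
    have hUfin : FiniteDimensional ℝ U := Module.finite_of_finrank_pos (by omega)
    -- a nonzero element of `U` orthogonal to the vectors found so far
    obtain ⟨v, hv0, hv⟩ : ∃ v : U, v ≠ 0 ∧ ∀ i, ⟪h i, (v : E)⟫_ℝ = 0 := by
      let f : U →ₗ[ℝ] (Fin m → ℝ) := LinearMap.pi fun i ↦ (innerₛₗ ℝ (h i)) ∘ₗ U.subtype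
      have hker : LinearMap.ker f ≠ ⊥ := by
        apply LinearMap.ker_ne_bot_of_finrank_lt
        simpa using (by omega : m < Module.finrank ℝ U)
      obtain ⟨v, hv, hv0⟩ := Submodule.exists_mem_ne_zero_of_ne_bot hker
      refine ⟨v, hv0, fun i ↦ ?_⟩
      have := congrFun (LinearMap.mem_ker.1 hv) i
      simpa [f] using this
    let W : Submodule ℝ E := (Submodule.span ℝ (Set.range h))ᗮ
    have hWmem : ∀ x, x ∈ W ↔ ∀ i, ⟪h i, x⟫_ℝ = 0 := by
      intro x
      rw [Submodule.mem_orthogonal]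
      constructor
      · intro hx i
        exact hx _ (Submodule.subset_span ⟨i, rfl⟩)
      · intro hx u hu
        induction hu using Submodule.span_induction with
        | mem x hx' => obtain ⟨i, rfl⟩ := hx'; exact hx i
        | zero => simp
        | add a b _ _ ha hb => rw [inner_add_left, ha, hb, add_zero]
        | smul c a _ ha => rw [real_inner_smul_left, ha, mul_zero]
    have hvW : (v : E) ∈ W := (hWmem _).2 hv
    have hjW : IsCompactOperator (j ∘L W.subtypeL) := hj.comp_clm _
    obtain ⟨c, hc, w, hw0, hw⟩ := exists_eigenvector_ge hjW hκ
      (h := ⟨v, hvW⟩) (by simpa using hv0) (by simpa using hU v v.2)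
    have hwW := (hWmem w).1 w.2
    have hspan : FiniteDimensional ℝ (Submodule.span ℝ (Set.range h)) :=
      FiniteDimensional.span_of_finite ℝ (Set.finite_range h)
    -- `hw` tests the eigenvector equation only against W. On the span of the earlier eigenvectors
    -- both sides vanish, because these are eigenvectors orthogonal to w.
    have hw' : ∀ x, ⟪j w, j x⟫_ℝ = c * ⟪(w : E), x⟫_ℝ := by
      intro x
      obtain ⟨y, hy, z, hz, rfl⟩ := (Submodule.span ℝ (Set.range h)).exists_add_mem_mem_orthogonal x
      have hzz := hw ⟨z, hz⟩
      simp only [ContinuousLinearMap.comp_apply, Submodule.subtypeL_apply,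
        Submodule.coe_inner] at hzz
      have hyy : ⟪j w, j y⟫_ℝ = c * ⟪(w : E), y⟫_ℝ := by
        induction hy using Submodule.span_induction with
        | mem x hx' =>
          obtain ⟨i, rfl⟩ := hx'
          rw [real_inner_comm, h4, hwW, real_inner_comm, hwW]; simp
        | zero => simp
        | add a b _ _ ha hb => rw [map_add, inner_add_right, inner_add_right, ha, hb, mul_add]
        | smul d a _ ha => rw [map_smul, inner_smul_right, inner_smul_right, ha]; ring
      rw [map_add, inner_add_right, inner_add_right, hyy, hzz, mul_add]
    refine ⟨Fin.cons w h, Fin.cons c κ', ?_, ?_, ?_, ?_⟩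
    · intro i; refine Fin.cases ?_ (fun i ↦ ?_) i
      · exact hc
      · exact h1 i
    · intro i; refine Fin.cases ?_ (fun i ↦ ?_) i
      · simpa using hw0
      · exact h2 i
    · intro i l
      refine Fin.cases ?_ (fun i ↦ ?_) i <;> refine Fin.cases ?_ (fun l ↦ ?_) l
      · intro h; exact absurd rfl h
      · intro _; simpa [real_inner_comm] using hwW l
      · intro _; simpa using hwW i
      · intro hil; simpa using h3 i l (fun h ↦ hil (by rw [h]))
    · intro i; refine Fin.cases ?_ (fun i ↦ ?_) i
      · exact hw'
      · exact h4 i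

end Spectral

/-! ### Eigenvalues of a nonnegative quadratic form relative to a map into a Hilbert space. -/

section Forms

open scoped InnerProductSpace

universe u

variable {V : Type u} {L : Type*} [AddCommGroup V] [Module ℝ V] [NormedAddCommGroup L]
  [InnerProductSpace ℝ L]

/-- The Hilbert space completion of `V` for the norm `(‖ι v‖² + D(v, v))^{1/2}`. -/
lemma exists_energySpace [CompleteSpace L] (ι : V →ₗ[ℝ] L) (D : LinearMap.BilinForm ℝ V)
    (hs : ∀ v w, D v w = D w v) (hp : ∀ v, 0 ≤ D v v) :
    ∃ (H : Type u) (_ : NormedAddCommGroup H) (_ : InnerProductSpace ℝ H) (_ : CompleteSpace H)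
      (e : V →ₗ[ℝ] H) (j : H →L[ℝ] L), DenseRange e ∧ (∀ v, j (e v) = ι v) ∧
      ∀ v w, ⟪e v, e w⟫_ℝ = ⟪ι v, ι w⟫_ℝ + D v w := by
  -- Only a semi-inner product, since ι and D may vanish on a common vector; the completion
  -- identifies such vectors with 0.
  let c : PreInnerProductSpace.Core ℝ V :=
    { inner := fun v w ↦ ⟪ι v, ι w⟫_ℝ + D v w
      conj_inner_symm := fun v w ↦ by simp [real_inner_comm, hs v w]
      re_inner_nonneg := fun v ↦ by
        simpa using add_nonneg (real_inner_self_nonneg (x := ι v)) (hp v)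
      add_left := fun u v w ↦ by simp [inner_add_left]; ring
      smul_left := fun u v r ↦ by simp [real_inner_smul_left]; ring }
  let _ : SeminormedAddCommGroup V :=
    InnerProductSpace.Core.toSeminormedAddCommGroup (𝕜 := ℝ) (c := c)
  let _ : InnerProductSpace ℝ V := InnerProductSpace.ofCore c
  have hin : ∀ v w : V, ⟪v, w⟫_ℝ = ⟪ι v, ι w⟫_ℝ + D v w := fun _ _ ↦ rfl
  have hle : ∀ v : V, ‖ι v‖ ≤ 1 * ‖v‖ := fun v ↦ by
    rw [one_mul]
    refine (abs_le_of_sq_le_sq' ?_ (norm_nonneg _)).2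
    rw [← real_inner_self_eq_norm_sq, ← real_inner_self_eq_norm_sq, hin]
    linarith [hp v]
  let ιc : V →L[ℝ] L := LinearMap.mkContinuous ι 1 hle
  let e : V →L[ℝ] UniformSpace.Completion V := UniformSpace.Completion.toComplL
  have hd : DenseRange e := UniformSpace.Completion.denseRange_coe
  have hi : IsUniformInducing e := UniformSpace.Completion.isUniformInducing_coe V
  refine ⟨UniformSpace.Completion V, inferInstance, inferInstance, inferInstance,
    e.toLinearMap, ιc.extend e, hd, fun v ↦ ?_, fun v w ↦ ?_⟩
  · exact ιc.extend_eq hd hi v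
  · rw [← hin]
    exact UniformSpace.Completion.inner_coe v w

/-- `u ∈ L` is a weak eigenvector with eigenvalue `μ` of the closure of the form `D`. -/
def IsFormEigenvector (ι : V →ₗ[ℝ] L) (D : LinearMap.BilinForm ℝ V) (μ : ℝ) (u : L) : Prop :=
  ∃ φ : ℕ → V, Tendsto (fun j ↦ ι (φ j)) atTop (𝓝 u) ∧
    Tendsto (fun p : ℕ × ℕ ↦ D (φ p.1 - φ p.2) (φ p.1 - φ p.2)) atTop (𝓝 0) ∧
    ∀ ψ, Tendsto (fun j ↦ D (φ j) ψ) atTop (𝓝 (μ * ⟪u, ι ψ⟫_ℝ))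

/-- The energy of every combination of the `u i` is at most `t` times its squared norm. -/
def HasEnergyBound {m : ℕ} (ι : V →ₗ[ℝ] L) (D : LinearMap.BilinForm ℝ V) (t : ℝ)
    (u : Fin m → L) : Prop :=
  ∃ φ : Fin m → ℕ → V, (∀ i, Tendsto (fun j ↦ ι (φ i j)) atTop (𝓝 (u i))) ∧
    (∀ i, Tendsto (fun p : ℕ × ℕ ↦ D (φ i p.1 - φ i p.2) (φ i p.1 - φ i p.2)) atTop (𝓝 0)) ∧
    ∀ a : Fin m → ℝ, ∀ δ > 0, ∀ᶠ j in atTop,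
      D (∑ i, a i • φ i j) (∑ i, a i • φ i j) ≤ t * ‖∑ i, a i • u i‖ ^ 2 + δ

/-- There are `k + 1` linearly independent eigenvectors with eigenvalues at most `t`. -/
def HasEigenvectors (ι : V →ₗ[ℝ] L) (D : LinearMap.BilinForm ℝ V) (k : ℕ) (t : ℝ) : Prop :=
  ∃ u : Fin (k + 1) → L, LinearIndependent ℝ u ∧ ∀ i, ∃ μ ≤ t, IsFormEigenvector ι D μ (u i)

/-- `D` controls the `L`-norm up to finitely many functionals, with arbitrarily small constant. -/
def IsCompactForm (ι : V →ₗ[ℝ] L) (D : LinearMap.BilinForm ℝ V) : Prop :=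
  ∀ ε > 0, ∃ (m : ℕ) (w : Fin m → L), ∀ v, ‖ι v‖ ^ 2 ≤ ε * D v v + ∑ i, ⟪w i, ι v⟫_ℝ ^ 2

/-- The same approximating sequences serve both forms: being Cauchy for D they are Cauchy for the
dominated form D'. This is the only place where two forms are compared. -/
lemma HasEnergyBound.of_le {m : ℕ} {ι : V →ₗ[ℝ] L} {D D' : LinearMap.BilinForm ℝ V} {t K : ℝ}
    {u : Fin m → L} (hK : 0 < K) (hp : ∀ v, 0 ≤ D' v v) (hD : ∀ v, D' v v ≤ K * D v v)
    (h : HasEnergyBound ι D t u) : HasEnergyBound ι D' (K * t) u := by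
  obtain ⟨φ, h1, h2, h3⟩ := h
  refine ⟨φ, h1, fun i ↦ ?_, fun a δ hδ ↦ ?_⟩
  · refine squeeze_zero (fun p ↦ hp _) (fun p ↦ hD _) ?_
    simpa using (h2 i).const_mul K
  · filter_upwards [h3 a (δ / K) (by positivity)] with j hj
    refine (hD _).trans ((mul_le_mul_of_nonneg_left hj hK.le).trans_eq ?_)
    field_simp

section Completion

variable {H : Type*} [NormedAddCommGroup H] [InnerProductSpace ℝ H]
  {ι : V →ₗ[ℝ] L} {D : LinearMap.BilinForm ℝ V} {e : V →ₗ[ℝ] H} {j : H →L[ℝ] L}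

/-- The squared energy distance is the squared L-distance plus D of the difference, so the two
hypotheses together say that the sequence is Cauchy in H. -/
lemma exists_tendsto_energySpace [CompleteSpace H] (hj : ∀ v, j (e v) = ι v)
    (hin : ∀ v w, ⟪e v, e w⟫_ℝ = ⟪ι v, ι w⟫_ℝ + D v w) {φ : ℕ → V} {u : L}
    (h1 : Tendsto (fun n ↦ ι (φ n)) atTop (𝓝 u))
    (h2 : Tendsto (fun p : ℕ × ℕ ↦ D (φ p.1 - φ p.2) (φ p.1 - φ p.2)) atTop (𝓝 0)) :
    ∃ h : H, Tendsto (fun n ↦ e (φ n)) atTop (𝓝 h) ∧ j h = u := by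
  have hc : CauchySeq (fun n ↦ e (φ n)) := by
    rw [cauchySeq_iff_tendsto_dist_atTop_0]
    have h3 : Tendsto (fun p : ℕ × ℕ ↦ dist (ι (φ p.1)) (ι (φ p.2))) atTop (𝓝 0) :=
      cauchySeq_iff_tendsto_dist_atTop_0.1 h1.cauchySeq
    have h4 := ((h3.pow 2).add h2).sqrt
    simp only [ne_eq, OfNat.ofNat_ne_zero, not_false_eq_true, zero_pow, add_zero,
      Real.sqrt_zero] at h4
    refine h4.congr fun p ↦ ?_
    rw [dist_eq_norm, dist_eq_norm, ← map_sub, ← map_sub, ← real_inner_self_eq_norm_sq, ← hin,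
      real_inner_self_eq_norm_sq, Real.sqrt_sq (norm_nonneg _)]
  obtain ⟨h, hh⟩ := cauchySeq_tendsto_of_complete hc
  refine ⟨h, hh, tendsto_nhds_unique ((j.continuous.tendsto h).comp hh) ?_⟩
  exact h1.congr fun n ↦ (hj _).symm

/-- D is the energy product minus the product of L. If j†j h = κh, the former is 1/κ times the
latter against h, which leaves the eigenvalue 1/κ - 1. -/
lemma isFormEigenvector_of_energySpace (he : DenseRange e) (hj : ∀ v, j (e v) = ι v)
    (hin : ∀ v w, ⟪e v, e w⟫_ℝ = ⟪ι v, ι w⟫_ℝ + D v w) {h : H} {κ : ℝ} (hκ : 0 < κ)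
    (hh : ∀ x, ⟪j h, j x⟫_ℝ = κ * ⟪h, x⟫_ℝ) : IsFormEigenvector ι D (1 / κ - 1) (j h) := by
  obtain ⟨f, hf, hlim⟩ := mem_closure_iff_seq_limit.1 (he h)
  choose φ hφ using hf
  obtain rfl : f = fun n ↦ e (φ n) := funext fun n ↦ (hφ n).symm
  have h1 : Tendsto (fun n ↦ ι (φ n)) atTop (𝓝 (j h)) :=
    ((j.continuous.tendsto h).comp hlim).congr fun n ↦ hj _
  refine ⟨φ, h1, ?_, fun ψ ↦ ?_⟩
  · have h2 := (cauchySeq_iff_tendsto_dist_atTop_0.1 hlim.cauchySeq).pow 2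
    have h3 := (cauchySeq_iff_tendsto_dist_atTop_0.1 h1.cauchySeq).pow 2
    have h4 := h2.sub h3
    simp only [ne_eq, OfNat.ofNat_ne_zero, not_false_eq_true, zero_pow, sub_zero] at h4
    refine h4.congr fun p ↦ ?_
    rw [dist_eq_norm, dist_eq_norm, ← map_sub, ← map_sub, ← real_inner_self_eq_norm_sq,
      ← real_inner_self_eq_norm_sq, hin]
    ring
  · have h2 : Tendsto (fun n ↦ ⟪e (φ n), e ψ⟫_ℝ - ⟪ι (φ n), ι ψ⟫_ℝ) atTop
        (𝓝 (⟪h, e ψ⟫_ℝ - ⟪j h, ι ψ⟫_ℝ)) :=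
      (hlim.inner tendsto_const_nhds).sub (h1.inner tendsto_const_nhds)
    have h3 : (1 / κ - 1) * ⟪j h, ι ψ⟫_ℝ = ⟪h, e ψ⟫_ℝ - ⟪j h, ι ψ⟫_ℝ := by
      have h4 := hh (e ψ)
      rw [hj] at h4
      rw [h4]; field_simp
    rw [h3]
    refine h2.congr fun n ↦ ?_
    rw [hin]; ring

/-- Orthogonality to the finitely many vectors j†w_i makes all the functionals vanish, and the
remaining term ε D is at most ε times the squared energy norm. -/
lemma isCompactOperator_of_isCompactForm [CompleteSpace L] [CompleteSpace H] (he : DenseRange e)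
    (hj : ∀ v, j (e v) = ι v) (hin : ∀ v w, ⟪e v, e w⟫_ℝ = ⟪ι v, ι w⟫_ℝ + D v w)
    (hc : IsCompactForm ι D) : IsCompactOperator j := by
  refine isCompactOperator_of_forall_small j fun ε hε ↦ ?_
  obtain ⟨m, w, hw⟩ := hc ε hε
  refine ⟨Submodule.span ℝ (Set.range fun i ↦ j.adjoint (w i)),
    FiniteDimensional.span_of_finite ℝ (Set.finite_range _), fun x hx ↦ ?_⟩
  have hall : ∀ x, ‖j x‖ ^ 2 ≤ ε * (‖x‖ ^ 2 - ‖j x‖ ^ 2) + ∑ i, ⟪w i, j x⟫_ℝ ^ 2 := by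
    intro x
    refine he.induction_on (p := fun x ↦
      ‖j x‖ ^ 2 ≤ ε * (‖x‖ ^ 2 - ‖j x‖ ^ 2) + ∑ i, ⟪w i, j x⟫_ℝ ^ 2) x ?_ fun v ↦ ?_
    · exact isClosed_le (by fun_prop) (by fun_prop)
    · have h1 := hin v v
      rw [real_inner_self_eq_norm_sq, real_inner_self_eq_norm_sq] at h1
      rw [hj, h1, add_sub_cancel_left]
      exact hw v
  have h0 : ∀ i, ⟪w i, j x⟫_ℝ = 0 := fun i ↦ by
    rw [← ContinuousLinearMap.adjoint_inner_left]
    exact (Submodule.mem_orthogonal _ _).1 hx _ (Submodule.subset_span ⟨i, rfl⟩)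
  have h1 := hall x
  simp only [h0, ne_eq, OfNat.ofNat_ne_zero, not_false_eq_true, zero_pow, Finset.sum_const_zero,
    add_zero] at h1
  nlinarith [mul_nonneg hε.le (sq_nonneg ‖j x‖)]

end Completion

lemma norm_sum_smul_sq {ι' : Type*} [Fintype ι'] (a : ι' → ℝ) (u : ι' → L) :
    ‖∑ i, a i • u i‖ ^ 2 = ∑ i, ∑ l, a i * a l * ⟪u i, u l⟫_ℝ := by
  rw [← real_inner_self_eq_norm_sq, sum_inner]
  refine Finset.sum_congr rfl fun i _ ↦ ?_
  rw [inner_sum]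
  refine Finset.sum_congr rfl fun l _ ↦ ?_
  rw [real_inner_smul_left, real_inner_smul_right]; ring

/-- Eigenvectors with eigenvalues at most `t` span a space of energy at most `t`. -/
lemma hasEnergyBound_of_isFormEigenvector [CompleteSpace L] {ι : V →ₗ[ℝ] L}
    {D : LinearMap.BilinForm ℝ V} (hs : ∀ v w, D v w = D w v) (hp : ∀ v, 0 ≤ D v v) {m : ℕ}
    {t : ℝ} {u : Fin m → L} (h : ∀ i, ∃ μ ≤ t, IsFormEigenvector ι D μ (u i)) :
    HasEnergyBound ι D t u := by
  obtain ⟨H, _, _, _, e, j, he, hj, hin⟩ := exists_energySpace ι D hs hp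
  choose μ hμ φ h1 h2 h3 using h
  choose x hx hjx using fun i ↦ exists_tendsto_energySpace hj hin (h1 i) (h2 i)
  -- The weak equation in the energy space: D contributes μ i and the product of L contributes 1;
  -- density extends it from V to H.
  have hxy : ∀ i y, ⟪x i, y⟫_ℝ = (1 + μ i) * ⟪u i, j y⟫_ℝ := by
    intro i y
    refine he.induction_on (p := fun y ↦ ⟪x i, y⟫_ℝ = (1 + μ i) * ⟪u i, j y⟫_ℝ) y ?_ fun v ↦ ?_
    · exact isClosed_eq (by fun_prop) (by fun_prop)
    · refine tendsto_nhds_unique ((hx i).inner tendsto_const_nhds) ?_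
      have h4 := ((h1 i).inner (tendsto_const_nhds (x := ι v))).add (h3 i v)
      rw [hj, add_mul, one_mul]
      exact h4.congr fun n ↦ (hin _ _).symm
  -- Eigenvectors with different eigenvalues are orthogonal.
  have hsymm : ∀ i l, μ i * ⟪u i, u l⟫_ℝ = μ l * ⟪u i, u l⟫_ℝ := by
    intro i l
    have h4 := hxy i (x l)
    have h5 := hxy l (x i)
    rw [real_inner_comm, h5, hjx, hjx, real_inner_comm] at h4
    linarith
  refine ⟨φ, h1, h2, fun a δ hδ ↦ ?_⟩
  have hlim : Tendsto (fun n ↦ D (∑ i, a i • φ i n) (∑ i, a i • φ i n)) atTop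
      (𝓝 (‖∑ i, a i • x i‖ ^ 2 - ‖∑ i, a i • u i‖ ^ 2)) := by
    have h4 : Tendsto (fun n ↦ ‖∑ i, a i • e (φ i n)‖ ^ 2 - ‖∑ i, a i • ι (φ i n)‖ ^ 2) atTop
        (𝓝 (‖∑ i, a i • x i‖ ^ 2 - ‖∑ i, a i • u i‖ ^ 2)) :=
      ((tendsto_finsetSum _ fun i _ ↦ (hx i).const_smul (a i)).norm.pow 2).sub
        ((tendsto_finsetSum _ fun i _ ↦ (h1 i).const_smul (a i)).norm.pow 2)
    refine h4.congr fun n ↦ ?_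
    simp_rw [← map_smul, ← map_sum]
    rw [← real_inner_self_eq_norm_sq, ← real_inner_self_eq_norm_sq, hin]
    ring
  have hle : ‖∑ i, a i • x i‖ ^ 2 - ‖∑ i, a i • u i‖ ^ 2 ≤ t * ‖∑ i, a i • u i‖ ^ 2 := by
    -- The gap between t‖∑ a_i u_i‖² and the energy is ∑ a_i a_l (t - μ_l)⟨u_i, u_l⟩. Since ⟨u_i,
    -- u_l⟩ = 0 unless μ_i = μ_l, the factor splits as √(t - μ_i)√(t - μ_l), and the gap is a
    -- squared norm. No orthogonality within an eigenspace is needed.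
    have h4 : ‖∑ i, (a i * √(t - μ i)) • u i‖ ^ 2
        = (1 + t) * ‖∑ i, a i • u i‖ ^ 2 - ‖∑ i, a i • x i‖ ^ 2 := by
      rw [norm_sum_smul_sq, norm_sum_smul_sq, norm_sum_smul_sq, Finset.mul_sum,
        ← Finset.sum_sub_distrib]
      refine Finset.sum_congr rfl fun i _ ↦ ?_
      rw [Finset.mul_sum, ← Finset.sum_sub_distrib]
      refine Finset.sum_congr rfl fun l _ ↦ ?_
      rw [hxy, hjx]
      rcases eq_or_ne (⟪u i, u l⟫_ℝ) 0 with h0 | h0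
      · simp [h0]
      · have h5 : μ i = μ l := mul_right_cancel₀ h0 (hsymm i l)
        have h6 : √(t - μ l) * √(t - μ l) = t - μ l := Real.mul_self_sqrt (by linarith [hμ l])
        rw [h5]
        linear_combination (a i * a l * ⟪u i, u l⟫_ℝ) * h6
    nlinarith [sq_nonneg ‖∑ i, (a i * √(t - μ i)) • u i‖]
  filter_upwards [hlim.eventually (gt_mem_nhds (by linarith :
    ‖∑ i, a i • x i‖ ^ 2 - ‖∑ i, a i • u i‖ ^ 2 < t * ‖∑ i, a i • u i‖ ^ 2 + δ))] with n hn
  exact hn.le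

/-- A `k + 1`-dimensional space of energy at most `t` yields `k + 1` eigenvectors with eigenvalues
at most `t`. -/
lemma HasEnergyBound.hasEigenvectors [CompleteSpace L] {ι : V →ₗ[ℝ] L}
    {D : LinearMap.BilinForm ℝ V} (hs : ∀ v w, D v w = D w v) (hp : ∀ v, 0 ≤ D v v)
    (hc : IsCompactForm ι D) {k : ℕ} {t : ℝ} (ht : 0 ≤ t) {u : Fin (k + 1) → L}
    (hu : LinearIndependent ℝ u) (h : HasEnergyBound ι D t u) : HasEigenvectors ι D k t := by
  obtain ⟨H, _, _, _, e, j, he, hj, hin⟩ := exists_energySpace ι D hs hp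
  obtain ⟨φ, h1, h2, h3⟩ := h
  choose x hx hjx using fun i ↦ exists_tendsto_energySpace hj hin (h1 i) (h2 i)
  have hxli : LinearIndependent ℝ x := by
    refine LinearIndependent.of_comp (j : H →ₗ[ℝ] L) ?_
    convert hu using 1
    exact funext fun i ↦ hjx i
  -- Energy at most t‖·‖² means squared energy norm at most (1 + t)‖·‖², a lower bound 1/(1 + t) for
  -- the Rayleigh quotient of j†j.
  have hκ : 0 < 1 / (1 + t) := by positivity
  have hU : ∀ y ∈ Submodule.span ℝ (Set.range x), 1 / (1 + t) * ‖y‖ ^ 2 ≤ ‖j y‖ ^ 2 := by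
    intro y hy
    obtain ⟨a, rfl⟩ := (Submodule.mem_span_range_iff_exists_fun ℝ).1 hy
    have hlim : Tendsto (fun n ↦ ‖∑ i, a i • e (φ i n)‖ ^ 2 - ‖∑ i, a i • ι (φ i n)‖ ^ 2) atTop
        (𝓝 (‖∑ i, a i • x i‖ ^ 2 - ‖∑ i, a i • u i‖ ^ 2)) :=
      ((tendsto_finsetSum _ fun i _ ↦ (hx i).const_smul (a i)).norm.pow 2).sub
        ((tendsto_finsetSum _ fun i _ ↦ (h1 i).const_smul (a i)).norm.pow 2)
    have hle : ‖∑ i, a i • x i‖ ^ 2 - ‖∑ i, a i • u i‖ ^ 2 ≤ t * ‖∑ i, a i • u i‖ ^ 2 := by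
      refine le_of_forall_pos_le_add fun δ hδ ↦ ?_
      refine le_of_tendsto hlim ?_
      filter_upwards [h3 a δ hδ] with n hn
      refine le_trans (le_of_eq ?_) hn
      simp_rw [← map_smul, ← map_sum]
      rw [← real_inner_self_eq_norm_sq, ← real_inner_self_eq_norm_sq, hin]
      ring
    have hjs : j (∑ i, a i • x i) = ∑ i, a i • u i := by simp [map_sum, hjx]
    rw [hjs, div_mul_eq_mul_div, one_mul, div_le_iff₀ (by positivity)]
    linarith
  obtain ⟨y, κ', hκ', hy0, hort, hev⟩ := exists_eigenvector_family
    (isCompactOperator_of_isCompactForm he hj hin hc) hκ hU (k + 1)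
    (by rw [finrank_span_eq_card hxli]; simp)
  have hpos : ∀ i, 0 < κ' i := fun i ↦ hκ.trans_le (hκ' i)
  refine ⟨fun i ↦ j (y i), ?_, fun i ↦ ⟨1 / κ' i - 1, ?_,
    isFormEigenvector_of_energySpace he hj hin (hpos i) (hev i)⟩⟩
  · refine linearIndependent_of_ne_zero_of_inner_eq_zero (𝕜 := ℝ) (fun i hi ↦ ?_)
      fun i l hil ↦ ?_
    · have h4 := hev i (y i)
      rw [hi, inner_zero_left, real_inner_self_eq_norm_sq] at h4
      have h5 := hpos i
      have h6 : 0 < ‖y i‖ ^ 2 := by have := hy0 i; positivity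
      nlinarith
    · change ⟪j (y i), j (y l)⟫_ℝ = 0
      rw [hev, hort i l hil, mul_zero]
  · have h4 : 1 / κ' i ≤ 1 + t := by
      rw [div_le_iff₀ (hpos i)]
      have h5 := hκ' i
      rw [div_le_iff₀ (by positivity)] at h5
      linarith
    linarith

/-- The eigenvalues of a nonnegative form are nonnegative. -/
lemma HasEigenvectors.nonneg [CompleteSpace L] {ι : V →ₗ[ℝ] L}
    {D : LinearMap.BilinForm ℝ V} (hs : ∀ v w, D v w = D w v) (hp : ∀ v, 0 ≤ D v v) {k : ℕ}
    {t : ℝ} (h : HasEigenvectors ι D k t) : 0 ≤ t := by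
  obtain ⟨u, hu, h⟩ := h
  obtain ⟨φ, h1, h2, h3⟩ := hasEnergyBound_of_isFormEigenvector hs hp h
  have h0 : u 0 ≠ 0 := hu.ne_zero 0
  have h4 : 0 ≤ t * ‖u 0‖ ^ 2 := by
    refine le_of_forall_pos_le_add fun δ hδ ↦ ?_
    obtain ⟨n, hn⟩ := (h3 (Pi.single 0 1) δ hδ).exists
    have h5 : ∑ i, (Pi.single 0 1 : Fin (k + 1) → ℝ) i • u i = u 0 := by
      rw [Finset.sum_eq_single 0] <;> simp +contextual
    rw [h5] at hn
    exact (hp _).trans hn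
  have h5 : 0 < ‖u 0‖ ^ 2 := by positivity
  by_contra hneg
  nlinarith

/-- Comparison of the eigenvalues of comparable forms. -/
lemma HasEigenvectors.of_le [CompleteSpace L] {ι : V →ₗ[ℝ] L} {D D' : LinearMap.BilinForm ℝ V}
    (hs : ∀ v w, D v w = D w v) (hp : ∀ v, 0 ≤ D v v) (hs' : ∀ v w, D' v w = D' w v)
    (hp' : ∀ v, 0 ≤ D' v v) (hc' : IsCompactForm ι D') {K : ℝ} (hK : 0 < K)
    (hD : ∀ v, D' v v ≤ K * D v v) {k : ℕ} {t : ℝ} (h : HasEigenvectors ι D k t) :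
    HasEigenvectors ι D' k (K * t) := by
  have ht := h.nonneg hs hp
  obtain ⟨u, hu, h⟩ := h
  exact ((hasEnergyBound_of_isFormEigenvector hs hp h).of_le hK hp' hD).hasEigenvectors hs' hp' hc'
    (by positivity) hu

/-- If `ι` has infinite dimensional range, there are arbitrarily many eigenvectors. -/
lemma exists_hasEigenvectors [CompleteSpace L] {ι : V →ₗ[ℝ] L} {D : LinearMap.BilinForm ℝ V}
    (hs : ∀ v w, D v w = D w v) (hp : ∀ v, 0 ≤ D v v) (hc : IsCompactForm ι D) {k : ℕ}
    (v : Fin (k + 1) → V) (hv0 : ∀ i, ι (v i) ≠ 0)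
    (hv : ∀ i l, i ≠ l → ⟪ι (v i), ι (v l)⟫_ℝ = 0) : ∃ t, HasEigenvectors ι D k t := by
  have hli : LinearIndependent ℝ fun i ↦ ι (v i) :=
    linearIndependent_of_ne_zero_of_inner_eq_zero (𝕜 := ℝ) hv0 fun i l hil ↦ hv i l hil
  -- A crude energy bound on the span of the v i: by orthogonality each |a_i|‖ι v_i‖ is at most the
  -- norm of the whole combination.
  set C : ℝ := ∑ i, ∑ l, |D (v i) (v l)| / (‖ι (v i)‖ * ‖ι (v l)‖) with hC
  have hC0 : 0 ≤ C := Finset.sum_nonneg fun i _ ↦ Finset.sum_nonneg fun l _ ↦ by positivity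
  refine ⟨C, HasEnergyBound.hasEigenvectors hs hp hc hC0 hli
    ⟨fun i _ ↦ v i, fun i ↦ tendsto_const_nhds, fun i ↦ by simp, fun a δ hδ ↦
      Eventually.of_forall fun _ ↦ ?_⟩⟩
  have hN : ∀ i, |a i| * ‖ι (v i)‖ ≤ ‖∑ i, a i • ι (v i)‖ := by
    intro i
    have h1 : ⟪∑ l, a l • ι (v l), ι (v i)⟫_ℝ = a i * ‖ι (v i)‖ ^ 2 := by
      rw [sum_inner, Finset.sum_eq_single i]
      · rw [real_inner_smul_left, real_inner_self_eq_norm_sq]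
      · intro l _ hl
        rw [real_inner_smul_left, hv l i hl, mul_zero]
      · simp
    have h2 := abs_real_inner_le_norm (∑ l, a l • ι (v l)) (ι (v i))
    rw [h1, abs_mul, abs_of_nonneg (sq_nonneg ‖ι (v i)‖), pow_two, ← mul_assoc] at h2
    exact le_of_mul_le_mul_right h2 (norm_pos_iff.2 (hv0 i))
  have h1 : D (∑ i, a i • v i) (∑ i, a i • v i) = ∑ i, ∑ l, a i * a l * D (v i) (v l) := by
    simp only [map_sum, LinearMap.sum_apply, map_smul, LinearMap.smul_apply, smul_eq_mul,
      Finset.mul_sum]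
    rw [Finset.sum_comm]
    refine Finset.sum_congr rfl fun i _ ↦ Finset.sum_congr rfl fun l _ ↦ by ring
  rw [h1, hC, Finset.sum_mul]
  refine le_trans (Finset.sum_le_sum fun i _ ↦ ?_) (le_add_of_nonneg_right hδ.le)
  rw [Finset.sum_mul]
  refine Finset.sum_le_sum fun l _ ↦ ?_
  have hi := norm_pos_iff.2 (hv0 i)
  have hl := norm_pos_iff.2 (hv0 l)
  calc a i * a l * D (v i) (v l) ≤ |a i| * |a l| * |D (v i) (v l)| := by
        rw [← abs_mul, ← abs_mul]; exact le_abs_self _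
    _ = |D (v i) (v l)| / (‖ι (v i)‖ * ‖ι (v l)‖) * ((|a i| * ‖ι (v i)‖) * (|a l| * ‖ι (v l)‖)) := by
        field_simp
    _ ≤ _ := by
        rw [pow_two]
        gcongr
        · exact hN i
        · exact hN l

/-- If `D` controls the distance to a line, the eigenvalues after the first are bounded below. -/
lemma HasEigenvectors.le_of_poincare [CompleteSpace L] {ι : V →ₗ[ℝ] L}
    {D : LinearMap.BilinForm ℝ V} (hs : ∀ v w, D v w = D w v) (hp : ∀ v, 0 ≤ D v v) {w : L}
    {C : ℝ} (hC : 0 < C) (hP : ∀ v, ∃ c : ℝ, ‖ι v - c • w‖ ^ 2 ≤ C * D v v) {k : ℕ} (hk : 1 ≤ k)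
    {t : ℝ} (h : HasEigenvectors ι D k t) : 1 / C ≤ t := by
  obtain ⟨u, hu, h⟩ := h
  obtain ⟨φ, h1, h2, h3⟩ := hasEnergyBound_of_isFormEigenvector hs hp h
  -- One linear condition on k + 1 ≥ 2 coefficients has a nonzero solution.
  obtain ⟨a, ha0, ha⟩ : ∃ a : Fin (k + 1) → ℝ, a ≠ 0 ∧ ⟪∑ i, a i • u i, w⟫_ℝ = 0 := by
    let f : (Fin (k + 1) → ℝ) →ₗ[ℝ] ℝ :=
      (innerₛₗ ℝ w) ∘ₗ (Fintype.linearCombination ℝ u)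
    have hker : LinearMap.ker f ≠ ⊥ := by
      apply LinearMap.ker_ne_bot_of_finrank_lt
      simp; omega
    obtain ⟨v, hv, hv0⟩ := Submodule.exists_mem_ne_zero_of_ne_bot hker
    refine ⟨v, hv0, ?_⟩
    rw [real_inner_comm]
    simpa [f, Fintype.linearCombination_apply] using LinearMap.mem_ker.1 hv
  set x := ∑ i, a i • u i with hx
  have hx0 : x ≠ 0 := fun h0 ↦ ha0 (funext fun i ↦
    Fintype.linearIndependent_iff.1 hu a h0 i)
  have hlim : Tendsto (fun n ↦ ι (∑ i, a i • φ i n)) atTop (𝓝 x) := by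
    simp only [map_sum, map_smul]
    exact tendsto_finsetSum _ fun i _ ↦ (h1 i).const_smul (a i)
  -- As x ⊥ w, the unknown constant c drops out of ⟨x, ι v - c w⟩. Letting ι v tend to x then gives
  -- ‖x‖⁴ ≤ C t ‖x‖⁴.
  have hle : ∀ v, ⟪x, ι v⟫_ℝ ^ 2 ≤ ‖x‖ ^ 2 * (C * D v v) := by
    intro v
    obtain ⟨c, hc⟩ := hP v
    have h4 : ⟪x, ι v⟫_ℝ = ⟪x, ι v - c • w⟫_ℝ := by
      rw [inner_sub_right, real_inner_smul_right, ha, mul_zero, sub_zero]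
    rw [h4]
    calc _ ≤ (‖x‖ * ‖ι v - c • w‖) ^ 2 := by
          rw [← sq_abs]; gcongr; exact abs_real_inner_le_norm _ _
      _ = ‖x‖ ^ 2 * ‖ι v - c • w‖ ^ 2 := by ring
      _ ≤ _ := by gcongr
  have hxx : (‖x‖ ^ 2) ^ 2 ≤ ‖x‖ ^ 2 * (C * (t * ‖x‖ ^ 2)) := by
    refine le_of_forall_pos_le_add fun δ hδ ↦ ?_
    have h4 : Tendsto (fun n ↦ ⟪x, ι (∑ i, a i • φ i n)⟫_ℝ ^ 2) atTop (𝓝 ((‖x‖ ^ 2) ^ 2)) := by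
      rw [← real_inner_self_eq_norm_sq]
      exact (tendsto_const_nhds.inner hlim).pow 2
    have hn0 : 0 < ‖x‖ ^ 2 := by positivity
    refine le_of_tendsto h4 ?_
    filter_upwards [h3 a (δ / (‖x‖ ^ 2 * C)) (by positivity)] with n hn
    rw [← hx] at hn
    refine (hle _).trans ((mul_le_mul_of_nonneg_left (mul_le_mul_of_nonneg_left hn hC.le)
      hn0.le).trans_eq ?_)
    field_simp
  have hn0 : 0 < (‖x‖ ^ 2) ^ 2 := by positivity
  rw [div_le_iff₀ hC]
  by_contra hneg
  push Not at hneg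
  nlinarith

end Forms

/-! ### The Poincaré inequality on convex sets of a Euclidean space. -/

section Poincare

lemma sq_lintegral_le {α : Type*} [MeasurableSpace α] {μ : Measure α} [IsProbabilityMeasure μ]
    {f : α → ℝ≥0∞} (hf : AEMeasurable f μ) : (∫⁻ x, f x ∂μ) ^ 2 ≤ ∫⁻ x, f x ^ 2 ∂μ := by
  have h := ENNReal.lintegral_mul_le_Lp_mul_Lq μ Real.HolderConjugate.two_two hf
    (aemeasurable_const (b := (1 : ℝ≥0∞)))
  simp only [Pi.mul_apply, mul_one, ENNReal.one_rpow, lintegral_const, measure_univ] at h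
  calc (∫⁻ x, f x ∂μ) ^ 2 ≤ ((∫⁻ x, f x ^ (2 : ℝ) ∂μ) ^ (1 / 2 : ℝ)) ^ 2 := by gcongr
    _ = ∫⁻ x, f x ^ (2 : ℝ) ∂μ := by
      rw [← ENNReal.rpow_natCast, ← ENNReal.rpow_mul]; norm_num
    _ = _ := by simp

variable {E : Type*} [NormedAddCommGroup E] [NormedSpace ℝ E]

/-- The fundamental theorem of calculus along the segment from y to x, then Cauchy–Schwarz in t. -/
lemma enorm_sub_sq_le_lintegral_segment {f : E → ℝ} {s O : Set E} (hs : Convex ℝ s)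
    (hO : IsOpen O) (hsO : s ⊆ O) (hf : ContDiffOn ℝ 1 f O) {x y : E} (hx : x ∈ s) (hy : y ∈ s) :
    ‖f x - f y‖ₑ ^ 2 ≤
      ‖x - y‖ₑ ^ 2 * ∫⁻ t in Set.Icc (0 : ℝ) 1, ‖fderiv ℝ f (y + t • (x - y))‖ₑ ^ 2 := by
  have hmem : ∀ t ∈ Set.Icc (0 : ℝ) 1, y + t • (x - y) ∈ O :=
    fun t ht ↦ hsO (hs.add_smul_sub_mem hy hx ht)
  have hγ : ContDiff ℝ 1 fun t : ℝ ↦ y + t • (x - y) := by fun_prop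
  have h1 : ContDiffOn ℝ 1 (fun t : ℝ ↦ f (y + t • (x - y))) (Set.Icc 0 1) :=
    hf.comp hγ.contDiffOn hmem
  have h2 := enorm_sub_le_lintegral_deriv_of_contDiffOn_Icc h1 zero_le_one
  simp only [one_smul, add_sub_cancel, zero_smul, add_zero] at h2
  have h3 : ∀ t ∈ Set.Icc (0 : ℝ) 1, ‖deriv (fun t : ℝ ↦ f (y + t • (x - y))) t‖ₑ ≤
      ‖x - y‖ₑ * ‖fderiv ℝ f (y + t • (x - y))‖ₑ := by
    intro t ht
    have h4 : HasFDerivAt f (fderiv ℝ f (y + t • (x - y))) (y + t • (x - y)) :=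
      ((hf.differentiableOn one_ne_zero).differentiableAt
        (hO.mem_nhds (hmem t ht))).hasFDerivAt
    have h5 : HasDerivAt (fun t : ℝ ↦ y + t • (x - y)) (x - y) t := by
      simpa using ((hasDerivAt_id t).smul_const (x - y)).const_add y
    have h6 := (h4.comp_hasDerivAt t h5).deriv
    simp only [Function.comp_def] at h6
    rw [h6, mul_comm]
    exact ContinuousLinearMap.le_opENorm _ _
  have hcont : ContinuousOn (fun t : ℝ ↦ fderiv ℝ f (y + t • (x - y))) (Set.Icc 0 1) :=
    (hf.continuousOn_fderiv_of_isOpen hO le_rfl).comp hγ.continuous.continuousOn hmem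
  have hprob : IsProbabilityMeasure (volume.restrict (Set.Icc (0 : ℝ) 1)) := ⟨by simp⟩
  have haem : AEMeasurable (fun t : ℝ ↦ ‖fderiv ℝ f (y + t • (x - y))‖ₑ)
      (volume.restrict (Set.Icc (0 : ℝ) 1)) :=
    (hcont.enorm).aemeasurable measurableSet_Icc
  calc ‖f x - f y‖ₑ ^ 2
      ≤ (∫⁻ t in Set.Icc (0 : ℝ) 1, ‖x - y‖ₑ * ‖fderiv ℝ f (y + t • (x - y))‖ₑ) ^ 2 := by
        gcongr
        exact h2.trans (setLIntegral_mono' measurableSet_Icc h3)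
    _ = ‖x - y‖ₑ ^ 2 * (∫⁻ t in Set.Icc (0 : ℝ) 1, ‖fderiv ℝ f (y + t • (x - y))‖ₑ) ^ 2 := by
        rw [lintegral_const_mul' _ _ (by simp), mul_pow]
    _ ≤ _ := by gcongr; exact sq_lintegral_le haem

variable [FiniteDimensional ℝ E] [MeasurableSpace E] [BorelSpace E] (μ : Measure E)
  [μ.IsAddHaarMeasure]

lemma lintegral_comp_smul_add (G : E → ℝ≥0∞) (hG : Measurable G) {t : ℝ} (ht : 0 < t) (c : E) :
    ∫⁻ x, G (t • x + c) ∂μ = ENNReal.ofReal (t⁻¹ ^ Module.finrank ℝ E) * ∫⁻ x, G x ∂μ := by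
  have h1 : Measurable fun x ↦ G (x + c) := hG.comp (measurable_add_const c)
  have h2 := lintegral_map (μ := μ) h1 (measurable_const_smul t)
  rw [← h2, Measure.map_addHaar_smul μ ht.ne', lintegral_smul_measure,
    lintegral_add_right_eq_self, abs_of_pos (by positivity), inv_pow, smul_eq_mul]

/-- The contraction of ratio t towards y maps s into itself, and its inverse Jacobian t^{-dim} is at
most 2^dim for t ≥ 1/2. -/
lemma setLIntegral_segment_le {G : E → ℝ≥0∞} (hG : Measurable G) {s : Set E} (hs : Convex ℝ s)
    (hsm : MeasurableSet s) {y : E} (hy : y ∈ s) {t : ℝ} (ht : 1 / 2 ≤ t) (ht1 : t ≤ 1) :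
    ∫⁻ x in s, G (y + t • (x - y)) ∂μ ≤ 2 ^ Module.finrank ℝ E * ∫⁻ x in s, G x ∂μ := by
  have ht0 : 0 < t := by linarith
  calc ∫⁻ x in s, G (y + t • (x - y)) ∂μ
      ≤ ∫⁻ x in s, s.indicator G (t • x + (y - t • y)) ∂μ := by
        refine setLIntegral_mono' hsm fun x hx ↦ ?_
        have h1 : t • x + (y - t • y) = y + t • (x - y) := by rw [smul_sub]; abel
        rw [h1, Set.indicator_of_mem (hs.add_smul_sub_mem hy hx ⟨ht0.le, ht1⟩)]
    _ ≤ ∫⁻ x, s.indicator G (t • x + (y - t • y)) ∂μ := setLIntegral_le_lintegral _ _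
    _ = ENNReal.ofReal (t⁻¹ ^ Module.finrank ℝ E) * ∫⁻ x in s, G x ∂μ := by
        rw [lintegral_comp_smul_add μ _ (hG.indicator hsm) ht0, lintegral_indicator hsm]
    _ ≤ _ := by
        gcongr
        rw [ENNReal.ofReal_pow (by positivity)]
        gcongr
        rw [ENNReal.ofReal_le_iff_le_toReal (by simp)]
        simp only [ENNReal.toReal_ofNat]
        rw [inv_le_comm₀ ht0 (by norm_num)]
        linarith

/-- The Jacobian t^{-dim} blows up at t = 0; for t ≤ 1/2 the roles of x and y are exchanged, which
replaces t by 1 - t. -/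
lemma lintegral_lintegral_segment_le {G : E → ℝ≥0∞} (hG : Measurable G) {s : Set E}
    (hs : Convex ℝ s) (hsm : MeasurableSet s) :
    ∫⁻ y in s, ∫⁻ x in s, (∫⁻ t in Set.Icc (0 : ℝ) 1, G (y + t • (x - y))) ∂μ ∂μ ≤
      μ s * (2 ^ Module.finrank ℝ E * ∫⁻ x in s, G x ∂μ) := by
  have hm : Measurable fun p : (E × E) × ℝ ↦ G (p.1.1 + p.2 • (p.1.2 - p.1.1)) := by fun_prop
  have hprob : IsProbabilityMeasure (volume.restrict (Set.Icc (0 : ℝ) 1)) := ⟨by simp⟩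
  have hfst : ∀ t ∈ Set.Icc (0 : ℝ) 1, ∫⁻ y in s, ∫⁻ x in s, G (y + t • (x - y)) ∂μ ∂μ ≤
      μ s * (2 ^ Module.finrank ℝ E * ∫⁻ x in s, G x ∂μ) := by
    have key : ∀ t : ℝ, 1 / 2 ≤ t → t ≤ 1 →
        ∫⁻ y in s, ∫⁻ x in s, G (y + t • (x - y)) ∂μ ∂μ ≤
          μ s * (2 ^ Module.finrank ℝ E * ∫⁻ x in s, G x ∂μ) := by
      intro t ht ht1
      refine (setLIntegral_mono' hsm fun y hy ↦
        setLIntegral_segment_le μ hG hs hsm hy ht ht1).trans ?_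
      rw [setLIntegral_const, mul_comm]
    intro t ht
    rcases le_total (1 / 2) t with h | h
    · exact key t h ht.2
    · have hsw : ∫⁻ y in s, ∫⁻ x in s, G (y + t • (x - y)) ∂μ ∂μ =
          ∫⁻ x in s, ∫⁻ y in s, G (x + (1 - t) • (y - x)) ∂μ ∂μ := by
        rw [lintegral_lintegral_swap (by fun_prop)]
        refine lintegral_congr fun x ↦ lintegral_congr fun y ↦ ?_
        congr 1
        rw [sub_smul, one_smul, smul_sub, smul_sub]; abel
      rw [hsw]
      exact key _ (by linarith) (by linarith [ht.1])
  have hsw : ∫⁻ y in s, ∫⁻ x in s, (∫⁻ t in Set.Icc (0 : ℝ) 1, G (y + t • (x - y))) ∂μ ∂μ =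
      ∫⁻ t in Set.Icc (0 : ℝ) 1, ∫⁻ y in s, ∫⁻ x in s, G (y + t • (x - y)) ∂μ ∂μ := by
    have h1 : ∀ y, ∫⁻ x in s, (∫⁻ t in Set.Icc (0 : ℝ) 1, G (y + t • (x - y))) ∂μ =
        ∫⁻ t in Set.Icc (0 : ℝ) 1, ∫⁻ x in s, G (y + t • (x - y)) ∂μ :=
      fun y ↦ lintegral_lintegral_swap (by fun_prop)
    simp_rw [h1]
    refine lintegral_lintegral_swap (Measurable.aemeasurable ?_)
    have h2 : Measurable fun p : (E × ℝ) × E ↦ G (p.1.1 + p.1.2 • (p.2 - p.1.1)) := by fun_prop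
    exact h2.lintegral_prod_right'
  rw [hsw]
  refine (setLIntegral_mono' measurableSet_Icc hfst).trans ?_
  simp

/-- The Poincaré inequality on a bounded convex set. -/
lemma exists_poincare_of_convex {s O : Set E} (hs : Convex ℝ s) (hsm : MeasurableSet s)
    (hfin : μ s ≠ ⊤) (hO : IsOpen O) (hsO : s ⊆ O) {d : ℝ}
    (hd : ∀ x ∈ s, ∀ y ∈ s, ‖x - y‖ ≤ d) {f : E → ℝ} (hf : ContDiffOn ℝ 1 f O) :
    ∃ c, ∫⁻ x in s, ‖f x - c‖ₑ ^ 2 ∂μ ≤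
      ENNReal.ofReal d ^ 2 * 2 ^ Module.finrank ℝ E * ∫⁻ x in s, ‖fderiv ℝ f x‖ₑ ^ 2 ∂μ := by
  rcases eq_or_ne (μ s) 0 with h0 | h0
  · exact ⟨0, by simp [Measure.restrict_eq_zero.2 h0]⟩
  set G : E → ℝ≥0∞ := fun x ↦ ‖fderiv ℝ f x‖ₑ ^ 2 with hG
  have hGm : Measurable G := (measurable_fderiv ℝ f).enorm.pow_const 2
  -- f is controlled only near s; extension by zero makes it globally measurable, as Tonelli's
  -- theorem requires.
  set h : E → ℝ := s.indicator f with hh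
  have hhm : Measurable h :=
    measurable_of_restrict_of_restrict_compl hsm
      (by
        have : s.domRestrict h = s.domRestrict f := by ext x; simp [hh]
        rw [this]
        exact (continuousOn_iff_continuous_domRestrict.1 (hf.continuousOn.mono hsO)).measurable)
      (by
        have : sᶜ.domRestrict h = fun _ ↦ 0 := by 
          ext ⟨x, hx⟩
          simp [hh, Set.indicator_of_notMem hx]
        rw [this]; exact measurable_const)
  have hdbl : ∫⁻ y in s, ∫⁻ x in s, ‖h x - h y‖ₑ ^ 2 ∂μ ∂μ ≤
      ENNReal.ofReal d ^ 2 * (μ s * (2 ^ Module.finrank ℝ E * ∫⁻ x in s, G x ∂μ)) := by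
    refine le_trans ?_ (mul_le_mul_right (lintegral_lintegral_segment_le μ hGm hs hsm) _)
    rw [← lintegral_const_mul' _ _ (by simp)]
    refine setLIntegral_mono' hsm fun y hy ↦ ?_
    rw [← lintegral_const_mul' _ _ (by simp)]
    refine setLIntegral_mono' hsm fun x hx ↦ ?_
    rw [hh, Set.indicator_of_mem hx, Set.indicator_of_mem hy]
    refine (enorm_sub_sq_le_lintegral_segment hs hO hsO hf hx hy).trans ?_
    gcongr
    rw [← ofReal_norm]
    exact ENNReal.ofReal_le_ofReal (hd x hx y hy)
  have hFm : Measurable fun y ↦ ∫⁻ x in s, ‖h x - h y‖ₑ ^ 2 ∂μ := by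
    have h2 : Measurable fun p : E × E ↦ ‖h p.2 - h p.1‖ₑ ^ 2 := by fun_prop
    exact h2.lintegral_prod_right'
  -- The constant is a value f(y), at a point y where ∫ |f - f(y)|² does not exceed its average over
  -- s.
  obtain ⟨y, hy, hle⟩ := exists_le_setLAverage h0 hfin hFm.aemeasurable
  refine ⟨h y, ?_⟩
  have h3 : ∫⁻ x in s, ‖f x - h y‖ₑ ^ 2 ∂μ = ∫⁻ x in s, ‖h x - h y‖ₑ ^ 2 ∂μ :=
    setLIntegral_congr_fun hsm fun x hx ↦ by simp [hh, hx]
  rw [h3]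
  refine hle.trans ?_
  rw [setLAverage_eq]
  refine ENNReal.div_le_of_le_mul (hdbl.trans_eq ?_)
  ring

/-- A bounded convex set is a finite disjoint union of convex sets of small diameter. -/
lemma exists_convex_partition {n : ℕ} {s : Set (EuclideanSpace ℝ (Fin n))} (hs : Convex ℝ s)
    (hsm : MeasurableSet s) (hb : Bornology.IsBounded s) {δ : ℝ} (hδ : 0 < δ) :
    ∃ (κ : Type) (_ : Fintype κ) (A : κ → Set (EuclideanSpace ℝ (Fin n))),
      (∀ i, Convex ℝ (A i)) ∧ (∀ i, MeasurableSet (A i)) ∧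
      (∀ i, ∀ x ∈ A i, ∀ y ∈ A i, ‖x - y‖ ≤ δ) ∧ Pairwise (fun i l ↦ Disjoint (A i) (A l)) ∧
      ⋃ i, A i = s := by
  -- Cells of the cubic grid of side 1/N have diameter at most √n/N ≤ δ; boundedness of s leaves
  -- finitely many of them.
  obtain ⟨N, hN⟩ := exists_nat_gt (√n / δ)
  have hN0 : (0 : ℝ) < N := lt_of_le_of_lt (by positivity) hN
  let q : EuclideanSpace ℝ (Fin n) → Fin n → ℤ := fun x i ↦ ⌊(N : ℝ) * x i⌋
  have hfin : (q '' s).Finite := by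
    obtain ⟨R, hR⟩ := hb.exists_norm_le
    refine (Set.Finite.pi fun _ : Fin n ↦ Set.finite_Icc ⌊-(N * R)⌋ ⌊N * R⌋).subset ?_
    rintro _ ⟨x, hx, rfl⟩ i _
    have h1 : |x i| ≤ R := (PiLp.norm_apply_le x i).trans (hR x hx)
    have h2 := abs_le.1 h1
    exact ⟨Int.floor_le_floor (by nlinarith), Int.floor_le_floor (by nlinarith)⟩
  have hmem : ∀ k x, q x = k ↔ ∀ i, (k i : ℝ) ≤ N * x i ∧ N * x i < k i + 1 := by
    intro k x
    rw [funext_iff]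
    exact forall_congr' fun i ↦ Int.floor_eq_iff
  refine ⟨q '' s, hfin.fintype, fun k ↦ s ∩ q ⁻¹' {k.1}, fun k ↦ ?_, fun k ↦ ?_,
    fun k x hx y hy ↦ ?_, fun k l hkl ↦ ?_, ?_⟩
  · refine hs.inter fun x hx y hy a b ha hb' hab ↦ ?_
    simp only [Set.mem_preimage, Set.mem_singleton_iff, hmem] at hx hy ⊢
    intro i
    obtain ⟨hx1, hx2⟩ := hx i
    obtain ⟨hy1, hy2⟩ := hy i
    obtain rfl : b = 1 - a := by linarith
    simp only [PiLp.add_apply, PiLp.smul_apply, smul_eq_mul]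
    constructor
    · nlinarith
    · rcases ha.eq_or_lt with rfl | ha
      · linarith
      · nlinarith
  · refine hsm.inter ?_
    have : q ⁻¹' {k.1} = ⋂ i, {x : EuclideanSpace ℝ (Fin n) |
        (k.1 i : ℝ) ≤ N * x i ∧ (N : ℝ) * x i < k.1 i + 1} := by
      ext x; simp [hmem]
    rw [this]
    refine MeasurableSet.iInter fun i ↦ ?_
    have hxi : Measurable fun x : EuclideanSpace ℝ (Fin n) ↦ (N : ℝ) * x i := by fun_prop
    exact (measurableSet_le measurable_const hxi).inter (measurableSet_lt hxi measurable_const)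
  · have hx' := (hmem _ _).1 hx.2
    have hy' := (hmem _ _).1 hy.2
    have h1 : ∀ i, ‖(x - y) i‖ ^ 2 ≤ (1 / N) ^ 2 := by
      intro i
      obtain ⟨hx1, hx2⟩ := hx' i
      obtain ⟨hy1, hy2⟩ := hy' i
      have h2 : |N * (x i - y i)| ≤ 1 := abs_le.2 ⟨by linarith, by linarith⟩
      rw [abs_mul, abs_of_pos hN0] at h2
      gcongr
      rw [PiLp.sub_apply, Real.norm_eq_abs, le_div_iff₀ hN0]; linarith
    rw [EuclideanSpace.norm_eq]
    calc √(∑ i, ‖(x - y) i‖ ^ 2) ≤ √(n * (1 / N) ^ 2) := by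
          gcongr
          refine (Finset.sum_le_sum fun i _ ↦ h1 i).trans_eq ?_
          simp
      _ = √n / N := by
          rw [Real.sqrt_mul (by positivity), Real.sqrt_sq (by positivity)]; ring
      _ ≤ δ := by
          rw [div_lt_iff₀ hδ] at hN
          rw [div_le_iff₀ hN0]; linarith
  · refine Set.disjoint_left.2 ?_
    rintro x ⟨_, hx⟩ ⟨_, hx'⟩
    exact hkl (Subtype.ext (hx.symm.trans hx'))
  · ext x
    simp only [Set.mem_iUnion, Set.mem_inter_iff, Set.mem_preimage, Set.mem_singleton_iff]
    exact ⟨fun ⟨_, h, _⟩ ↦ h, fun h ↦ ⟨⟨q x, x, h, rfl⟩, h, rfl⟩⟩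

end Poincare

/-! ### The metric and its volume density in the preferred charts. -/

section Charts

variable {n : ℕ} {M : Type*} [TopologicalSpace M]
  [ChartedSpace (EuclideanSpace ℝ (Fin n)) M]

/-- The derivative of the inverse of the preferred chart at `x`, as a map of the model space. -/
def symmDeriv (x : M) (e : EuclideanSpace ℝ (Fin n)) :
    EuclideanSpace ℝ (Fin n) →L[ℝ] EuclideanSpace ℝ (Fin n) :=
  mfderiv 𝓘(ℝ, EuclideanSpace ℝ (Fin n)) (𝓡 n) (extChartAt (𝓡 n) x).symm e

variable [IsManifold (𝓡 n) ∞ M] {r : WithTop ℕ∞}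

/-- The metric at `p`, as a bilinear form on the model space. -/
def modelForm (g : Metric n r M) (p : M) :
    EuclideanSpace ℝ (Fin n) →L[ℝ] EuclideanSpace ℝ (Fin n) →L[ℝ] ℝ :=
  g.inner p

/-- The metric in the preferred chart at `x`, at the point with coordinates `e`. -/
def chartForm (g : Metric n r M) (x : M) (e : EuclideanSpace ℝ (Fin n)) :
    EuclideanSpace ℝ (Fin n) →L[ℝ] EuclideanSpace ℝ (Fin n) →L[ℝ] ℝ :=
  (modelForm g ((extChartAt (𝓡 n) x).symm e)).bilinearComp (symmDeriv x e) (symmDeriv x e)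

lemma modelForm_symm (g : Metric n r M) (p : M) (v w : EuclideanSpace ℝ (Fin n)) :
    modelForm g p v w = modelForm g p w v := g.symm p v w

lemma modelForm_pos (g : Metric n r M) (p : M) {v : EuclideanSpace ℝ (Fin n)} (hv : v ≠ 0) :
    0 < modelForm g p v v := g.pos p v hv

lemma chartForm_apply (g : Metric n r M) (x : M) (e v w : EuclideanSpace ℝ (Fin n)) :
    chartForm g x e v w = modelForm g ((extChartAt (𝓡 n) x).symm e) (symmDeriv x e v)
      (symmDeriv x e w) := rfl

lemma isManifold_one : IsManifold (𝓡 n) 1 M := IsManifold.of_le (n := ∞) (by simp)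

lemma mdifferentiableAt_symm (x : M) {e : EuclideanSpace ℝ (Fin n)}
    (he : e ∈ (extChartAt (𝓡 n) x).target) :
    MDifferentiableAt 𝓘(ℝ, EuclideanSpace ℝ (Fin n)) (𝓡 n) (extChartAt (𝓡 n) x).symm e := by
  have : IsManifold (𝓡 n) 1 M := isManifold_one
  have h := mdifferentiableWithinAt_extChartAt_symm he
  rwa [ModelWithCorners.range_eq_univ, mdifferentiableWithinAt_univ] at h

lemma isInvertible_symmDeriv (x : M) {e : EuclideanSpace ℝ (Fin n)}
    (he : e ∈ (extChartAt (𝓡 n) x).target) : (symmDeriv x e).IsInvertible := by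
  have : IsManifold (𝓡 n) 1 M := isManifold_one
  have h := isInvertible_mfderivWithin_extChartAt_symm he
  rw [ModelWithCorners.range_eq_univ, mfderivWithin_univ] at h
  exact h

lemma chartForm_pos (g : Metric n r M) (x : M) {e : EuclideanSpace ℝ (Fin n)}
    (he : e ∈ (extChartAt (𝓡 n) x).target) {v : EuclideanSpace ℝ (Fin n)} (hv : v ≠ 0) :
    0 < chartForm g x e v v := by
  obtain ⟨A, hA⟩ := isInvertible_symmDeriv x he
  rw [chartForm_apply]
  refine modelForm_pos g _ ?_
  rw [← hA]
  exact (map_ne_zero_iff _ A.injective).2 hv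

lemma chartDensity_eq (g : Metric n r M) (x : M) (e : EuclideanSpace ℝ (Fin n)) :
    chartDensity g x e = √(Matrix.of fun i l : Fin n ↦ chartForm g x e
      (EuclideanSpace.single i 1) (EuclideanSpace.single l 1)).det := rfl

lemma chartDensity_pos (g : Metric n r M) (x : M) {e : EuclideanSpace ℝ (Fin n)}
    (he : e ∈ (extChartAt (𝓡 n) x).target) : 0 < chartDensity g x e := by
  rw [chartDensity_eq, Real.sqrt_pos]
  refine Matrix.PosDef.det_pos ?_
  refine Matrix.PosDef.of_dotProduct_mulVec_pos ?_ fun a ha ↦ ?_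
  · ext i l
    simp only [Matrix.conjTranspose_apply, Matrix.of_apply, star_trivial]
    rw [chartForm_apply, modelForm_symm]; rfl
  · have h := chartForm_pos g x he (v := WithLp.toLp 2 a) (by simpa using ha)
    have h2 : (WithLp.toLp 2 a : EuclideanSpace ℝ (Fin n)) =
        ∑ i, a i • EuclideanSpace.single i (1 : ℝ) := by
      ext l; simp [Finset.sum_apply, EuclideanSpace.single, Pi.single_apply]
    rw [h2] at h
    refine h.trans_eq ?_
    simp only [map_sum, map_smul, _root_.sum_apply, _root_.smul_apply,
      smul_eq_mul, dotProduct, Matrix.mulVec, Matrix.of_apply, star_trivial, Pi.star_apply,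
      Finset.mul_sum]
    rw [Finset.sum_comm]
    refine Finset.sum_congr rfl fun i _ ↦ Finset.sum_congr rfl fun l _ ↦ by ring

/-- The metric is continuous, read in the preferred chart at `x`. -/
lemma continuousAt_chartForm (g : Metric n r M) (x : M) :
    ContinuousAt (chartForm g x) (extChartAt (𝓡 n) x x) := by
  have : IsManifold (𝓡 n) 1 M := isManifold_one
  have h1 : ContinuousAt (fun y ↦ ContinuousLinearMap.inCoordinates (EuclideanSpace ℝ (Fin n))
      (fun y : M ↦ TangentSpace (𝓡 n) y) (EuclideanSpace ℝ (Fin n) →L[ℝ] ℝ)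
      (fun y : M ↦ TangentSpace (𝓡 n) y →L[ℝ] ℝ) x y x y (g.inner y)) x := by
    have W := g.contMDiff.continuous.continuousAt (x := x)
    simp only [continuousAt_hom_bundle] at W
    exact W.2
  have h2 : ContinuousAt (fun y ↦ chartForm g x (extChartAt (𝓡 n) x y)) x := by
    refine h1.congr ?_
    filter_upwards [extChartAt_source_mem_nhds (I := 𝓡 n) x] with y hy
    rw [extChartAt_source] at hy
    ext v w
    have hb : y ∈ (trivializationAt (EuclideanSpace ℝ (Fin n))
        (fun y : M ↦ TangentSpace (𝓡 n) y) x).baseSet := by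
      simpa using hy
    have h3 := inCoordinates_apply_eq₂ (𝕜 := ℝ) (F₃ := ℝ) (E₃ := Bundle.Trivial M ℝ)
      (x₀ := x) (x := y) (ϕ := g.inner y) (v := v) (w := w)
      hb hb (Set.mem_univ y : y ∈ (trivializationAt ℝ (Bundle.Trivial M ℝ) x).baseSet)
    have h4 := TangentBundle.symmL_trivializationAt (I := 𝓡 n) hy
    rw [ModelWithCorners.range_eq_univ, mfderivWithin_univ] at h4
    have h5 : ∀ v, (trivializationAt (EuclideanSpace ℝ (Fin n))
        (fun y : M ↦ TangentSpace (𝓡 n) y) x).symm y v =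
          symmDeriv x (extChartAt (𝓡 n) x y) v := fun v ↦
      (Bundle.Trivialization.symmL_apply (R := ℝ) _ hb v).symm.trans <| congrArg (fun f : EuclideanSpace ℝ (Fin n) →L[ℝ] EuclideanSpace ℝ (Fin n) ↦ f v) h4
    have h6 : (extChartAt (𝓡 n) x).symm (extChartAt (𝓡 n) x y) = y :=
      (extChartAt (𝓡 n) x).left_inv (by rwa [extChartAt_source])
    rw [h3, h5, h5, chartForm_apply, h6]
    simp only [Bundle.Trivial.fiberBundle_trivializationAt', Bundle.Trivial.linearMapAt_trivialization]
    rfl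
  have h3 : ContinuousAt (extChartAt (𝓡 n) x).symm (extChartAt (𝓡 n) x x) :=
    continuousAt_extChartAt_symm x
  have h4 : (extChartAt (𝓡 n) x).symm (extChartAt (𝓡 n) x x) = x := extChartAt_to_inv x
  have h5 := ContinuousAt.comp_of_eq h2 h3 h4
  refine h5.congr ?_
  filter_upwards [extChartAt_target_mem_nhds (I := 𝓡 n) x] with e he
  rw [Function.comp_apply, (extChartAt (𝓡 n) x).right_inv he]

/-- The inverse of a chart, followed by another chart. -/
lemma exists_transition (g : Metric n r M) {x y : M} {e : EuclideanSpace ℝ (Fin n)}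
    (he : e ∈ (extChartAt (𝓡 n) x).target)
    (hy : (extChartAt (𝓡 n) x).symm e ∈ (extChartAt (𝓡 n) y).source) :
    ∃ τ' : EuclideanSpace ℝ (Fin n) →L[ℝ] EuclideanSpace ℝ (Fin n),
      HasFDerivAt (extChartAt (𝓡 n) y ∘ (extChartAt (𝓡 n) x).symm) τ' e ∧
      chartDensity g x e = |τ'.det| *
        chartDensity g y (extChartAt (𝓡 n) y ((extChartAt (𝓡 n) x).symm e)) := by
  have : IsManifold (𝓡 n) 1 M := isManifold_one
  set τ := extChartAt (𝓡 n) y ∘ (extChartAt (𝓡 n) x).symm with hτ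
  have h1 := mdifferentiableAt_symm x he
  have h2 : MDifferentiableAt (𝓡 n) 𝓘(ℝ, EuclideanSpace ℝ (Fin n)) (extChartAt (𝓡 n) y)
      ((extChartAt (𝓡 n) x).symm e) :=
    mdifferentiableAt_extChartAt (by rwa [extChartAt_source] at hy)
  have h3 : MDifferentiableAt 𝓘(ℝ, EuclideanSpace ℝ (Fin n)) 𝓘(ℝ, EuclideanSpace ℝ (Fin n)) τ e :=
    h2.comp e h1
  have h4 : HasFDerivAt τ (fderiv ℝ τ e) e := h3.differentiableAt.hasFDerivAt
  refine ⟨fderiv ℝ τ e, h4, ?_⟩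
  have hye : τ e ∈ (extChartAt (𝓡 n) y).target := (extChartAt (𝓡 n) y).map_source hy
  have hpt : (extChartAt (𝓡 n) y).symm (τ e) = (extChartAt (𝓡 n) x).symm e :=
    (extChartAt (𝓡 n) y).left_inv hy
  have hder : symmDeriv x e = (symmDeriv y (τ e)).comp (fderiv ℝ τ e) := by
    have h5 : (extChartAt (𝓡 n) x).symm =ᶠ[𝓝 e] (extChartAt (𝓡 n) y).symm ∘ τ := by
      have h6 : ∀ᶠ e' in 𝓝 e, (extChartAt (𝓡 n) x).symm e' ∈ (extChartAt (𝓡 n) y).source :=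
        h1.continuousAt.eventually ((isOpen_extChartAt_source y).mem_nhds hy)
      filter_upwards [h6] with e' he'
      exact ((extChartAt (𝓡 n) y).left_inv he').symm
    have h7 : symmDeriv x e = mfderiv 𝓘(ℝ, EuclideanSpace ℝ (Fin n)) (𝓡 n)
        ((extChartAt (𝓡 n) y).symm ∘ τ) e := h5.mfderiv_eq
    rw [h7, mfderiv_comp e (mdifferentiableAt_symm y hye) h3, mfderiv_eq_fderiv]
    rfl
  have hform : ∀ v w, chartForm g x e v w =
      chartForm g y (τ e) (fderiv ℝ τ e v) (fderiv ℝ τ e w) := by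
    intro v w
    rw [chartForm_apply, chartForm_apply, hpt, hder]
    rfl
  let b := (EuclideanSpace.basisFun (Fin n) ℝ).toBasis
  let B : ∀ x e, EuclideanSpace ℝ (Fin n) →ₗ[ℝ] EuclideanSpace ℝ (Fin n) →ₗ[ℝ] ℝ :=
    fun x e ↦ LinearMap.mk₂ ℝ (fun v w ↦ chartForm g x e v w) (by simp) (by simp) (by simp) (by simp)
  have hB : ∀ x e, chartDensity g x e = √(LinearMap.toMatrix₂ b b (B x e)).det := by
    intro x e
    rw [chartDensity_eq]
    congr 2
  have hBB : B x e = (B y (τ e)).compl₁₂ (fderiv ℝ τ e : _ →ₗ[ℝ] _) (fderiv ℝ τ e : _ →ₗ[ℝ] _) := by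
    ext v w
    exact hform _ _
  -- The Gram matrix changes by AᵀGA, so its determinant gains det(A)² and the density gains |det
  -- A|.
  rw [hB, hBB, LinearMap.toMatrix₂_compl₁₂ b b, Matrix.det_mul, Matrix.det_mul,
    Matrix.det_transpose, LinearMap.det_toMatrix]
  change _ = _ * chartDensity g y (τ e)
  rw [hB, ← Real.sqrt_sq_eq_abs, ← Real.sqrt_mul (sq_nonneg _)]
  congr 1
  change _ * _ * LinearMap.det _ = LinearMap.det _ ^ 2 * _
  ring

end Charts

/-! ### The inverse metric and local bounds in charts. -/

section Cometric

variable {n : ℕ} {M : Type*} [TopologicalSpace M]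
  [ChartedSpace (EuclideanSpace ℝ (Fin n)) M] [IsManifold (𝓡 n) ∞ M] {r : WithTop ℕ∞}

lemma inner_flat_symm (g : Metric n r M) (x : M) (α : TangentSpace (𝓡 n) x →L[ℝ] ℝ)
    (v : TangentSpace (𝓡 n) x) : g.inner x ((flat g x).symm α) v = α v := by
  have h : flat g x ((flat g x).symm α) = α := (flat g x).apply_symm_apply α
  exact congrArg (fun f : TangentSpace (𝓡 n) x →L[ℝ] ℝ ↦ f v) h

lemma cometric_eq_apply (g : Metric n r M) (x : M) (α β : TangentSpace (𝓡 n) x →L[ℝ] ℝ) :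
    cometric g x α β = α ((flat g x).symm β) :=
  inner_flat_symm g x α _

lemma cometric_symm (g : Metric n r M) (x : M) (α β : TangentSpace (𝓡 n) x →L[ℝ] ℝ) :
    cometric g x α β = cometric g x β α := g.symm x _ _

lemma inner_self_nonneg (g : Metric n r M) (x : M) (v : TangentSpace (𝓡 n) x) :
    0 ≤ g.inner x v v := by
  rcases eq_or_ne v 0 with rfl | h
  · simp
  · exact (g.pos x v h).le

lemma cometric_self_nonneg (g : Metric n r M) (x : M) (α : TangentSpace (𝓡 n) x →L[ℝ] ℝ) :
    0 ≤ cometric g x α α := inner_self_nonneg g x _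

lemma cometric_add_left (g : Metric n r M) (x : M) (α α' β : TangentSpace (𝓡 n) x →L[ℝ] ℝ) :
    cometric g x (α + α') β = cometric g x α β + cometric g x α' β := by
  simp only [cometric_eq_apply]; rfl

lemma cometric_smul_left (g : Metric n r M) (x : M) (c : ℝ)
    (α β : TangentSpace (𝓡 n) x →L[ℝ] ℝ) :
    cometric g x (c • α) β = c * cometric g x α β := by
  simp only [cometric_eq_apply]; rfl

lemma inner_sq_le (g : Metric n r M) (x : M) (v w : TangentSpace (𝓡 n) x) :
    g.inner x v w ^ 2 ≤ g.inner x v v * g.inner x w w := by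
  have h : ∀ t : ℝ, 0 ≤ g.inner x w w * (t * t) + (2 * g.inner x v w) * t + g.inner x v v := by
    intro t
    have h1 := inner_self_nonneg g x (v + t • w)
    have h2 : g.inner x (v + t • w) (v + t • w) =
        g.inner x v v + t * g.inner x v w + (t * g.inner x w v + t * (t * g.inner x w w)) := by
      rw [map_add, map_smul, g.symm x (v + t • w) v, g.symm x (v + t • w) w, map_add, map_add,
        map_smul, map_smul, smul_eq_mul, smul_eq_mul, smul_eq_mul]
      ring
    rw [h2, g.symm x w v] at h1
    linarith
  have := discrim_le_zero h
  rw [discrim] at this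
  nlinarith

lemma sq_apply_le_cometric (g : Metric n r M) (x : M) (α : TangentSpace (𝓡 n) x →L[ℝ] ℝ)
    (v : TangentSpace (𝓡 n) x) : α v ^ 2 ≤ cometric g x α α * g.inner x v v := by
  rw [← inner_flat_symm g x α v]
  exact inner_sq_le g x _ _

/-- Inversion reverses the order of quadratic forms. Let v be the g₀-dual vector of α, so that α(v)
= |α|₀² = g₀(v, v). Cauchy–Schwarz for g₁ gives |α|₀⁴ ≤ |α|₁² g₁(v, v) ≤ K |α|₁² |α|₀². -/
lemma cometric_le_of_inner_le {g₀ g₁ : Metric n r M} {K : ℝ} {x : M}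
    (h : ∀ v : TangentSpace (𝓡 n) x, g₁.inner x v v ≤ K * g₀.inner x v v)
    (α : TangentSpace (𝓡 n) x →L[ℝ] ℝ) : cometric g₀ x α α ≤ K * cometric g₁ x α α := by
  have h1 := sq_apply_le_cometric g₁ x α ((flat g₀ x).symm α)
  have h2 := h ((flat g₀ x).symm α)
  rw [← cometric_eq_apply] at h1
  change _ ≤ K * cometric g₀ x α α at h2
  have h3 := cometric_self_nonneg g₁ x α
  rcases (cometric_self_nonneg g₀ x α).eq_or_lt with h0 | h0
  · rw [← h0] at h2 ⊢
    have h4 := inner_self_nonneg g₁ x ((flat g₀ x).symm α)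
    by_contra hneg
    have h5 : (flat g₀ x).symm α = 0 := by
      by_contra hne
      exact (g₀.pos x _ hne).ne h0
    have h6 : α = 0 := by simpa using h5
    rw [h6] at hneg
    simp [cometric] at hneg
  · have h5 : cometric g₀ x α α * cometric g₀ x α α ≤ (K * cometric g₁ x α α) * cometric g₀ x α α := by
      calc _ = cometric g₀ x α α ^ 2 := by ring
        _ ≤ _ := h1
        _ ≤ cometric g₁ x α α * (K * cometric g₀ x α α) := by gcongr
        _ = _ := by ring
    exact le_of_mul_le_mul_right h5 h0

lemma isInvertible_chartForm (g : Metric n r M) (x : M) {e : EuclideanSpace ℝ (Fin n)}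
    (he : e ∈ (extChartAt (𝓡 n) x).target) : (chartForm g x e).IsInvertible := by
  have hinj : Function.Injective (chartForm g x e).toLinearMap := by
    rw [← LinearMap.ker_eq_bot, LinearMap.ker_eq_bot']
    intro v hv
    by_contra hne
    have h := chartForm_pos g x he hne
    have h0 : chartForm g x e v = 0 := hv
    rw [h0] at h
    exact lt_irrefl _ h
  have hrank : Module.finrank ℝ (EuclideanSpace ℝ (Fin n)) =
      Module.finrank ℝ (EuclideanSpace ℝ (Fin n) →L[ℝ] ℝ) := by
    rw [← (LinearMap.toContinuousLinearMap (𝕜 := ℝ) (E := EuclideanSpace ℝ (Fin n))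
      (F' := ℝ)).finrank_eq, Subspace.dual_finrank_eq]
  exact ⟨(LinearEquiv.ofInjectiveOfFinrankEq _ hinj hrank).toContinuousLinearEquiv,
    by ext v w; rfl⟩

/-- Expressing the inverse metric through inversion of operators on the fixed model space makes its
continuity in e a consequence of the continuity of inversion. -/
lemma cometric_eq_chartForm (g : Metric n r M) (x : M) {e : EuclideanSpace ℝ (Fin n)}
    (he : e ∈ (extChartAt (𝓡 n) x).target) (α β : EuclideanSpace ℝ (Fin n) →L[ℝ] ℝ) :
    cometric g ((extChartAt (𝓡 n) x).symm e) α β =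
      α.comp (symmDeriv x e) ((chartForm g x e).inverse (β.comp (symmDeriv x e))) := by
  obtain ⟨A, hA⟩ := isInvertible_symmDeriv x he
  set w : EuclideanSpace ℝ (Fin n) := (flat g ((extChartAt (𝓡 n) x).symm e)).symm β with hw
  have h1 : ∀ v, modelForm g ((extChartAt (𝓡 n) x).symm e) w v = β v :=
    fun v ↦ inner_flat_symm g _ β v
  have hAw : symmDeriv x e (A.symm w) = w := by rw [← hA]; exact A.apply_symm_apply w
  have h2 : β.comp (symmDeriv x e) = chartForm g x e (A.symm w) := by
    ext v
    rw [chartForm_apply, hAw, h1]; rfl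
  refine (cometric_eq_apply g _ _ _).trans ?_
  change α w = _
  rw [(isInvertible_chartForm g x he).inverse_apply_eq.2 h2]
  exact congrArg α hAw.symm

lemma contDiffOn_chart (φ : C^∞⟮𝓡 n, M; ℝ⟯) (x : M) :
    ContDiffOn ℝ ∞ (φ ∘ (extChartAt (𝓡 n) x).symm) (extChartAt (𝓡 n) x).target := by
  rw [← contMDiffOn_iff_contDiffOn]
  exact φ.contMDiff.comp_contMDiffOn (contMDiffOn_extChartAt_symm x)

/-- The differential of `φ` at `p`, as a covector of the model space. -/
def modelDeriv (φ : C^∞⟮𝓡 n, M; ℝ⟯) (p : M) : EuclideanSpace ℝ (Fin n) →L[ℝ] ℝ :=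
  mfderiv (𝓡 n) 𝓘(ℝ, ℝ) φ p

lemma fderiv_chart (φ : C^∞⟮𝓡 n, M; ℝ⟯) (x : M) {e : EuclideanSpace ℝ (Fin n)}
    (he : e ∈ (extChartAt (𝓡 n) x).target) :
    fderiv ℝ (φ ∘ (extChartAt (𝓡 n) x).symm) e =
      (modelDeriv φ ((extChartAt (𝓡 n) x).symm e)).comp (symmDeriv x e) := by
  rw [← mfderiv_eq_fderiv]
  exact mfderiv_comp e ((φ.contMDiff.mdifferentiable (by simp)) _) (mdifferentiableAt_symm x he)

lemma cometric_mfderiv_eq (g : Metric n r M) (φ ψ : C^∞⟮𝓡 n, M; ℝ⟯) (x : M)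
    {e : EuclideanSpace ℝ (Fin n)} (he : e ∈ (extChartAt (𝓡 n) x).target) :
    cometric g ((extChartAt (𝓡 n) x).symm e)
        (mfderiv (𝓡 n) 𝓘(ℝ, ℝ) φ ((extChartAt (𝓡 n) x).symm e))
        (mfderiv (𝓡 n) 𝓘(ℝ, ℝ) ψ ((extChartAt (𝓡 n) x).symm e)) =
      fderiv ℝ (φ ∘ (extChartAt (𝓡 n) x).symm) e
        ((chartForm g x e).inverse (fderiv ℝ (ψ ∘ (extChartAt (𝓡 n) x).symm) e)) := by
  rw [fderiv_chart φ x he, fderiv_chart ψ x he]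
  exact cometric_eq_chartForm g x he _ _

lemma continuous_cometric_mfderiv (g : Metric n r M) (φ ψ : C^∞⟮𝓡 n, M; ℝ⟯) :
    Continuous fun p ↦ cometric g p (mfderiv (𝓡 n) 𝓘(ℝ, ℝ) φ p)
      (mfderiv (𝓡 n) 𝓘(ℝ, ℝ) ψ p) := by
  rw [continuous_iff_continuousAt]
  intro x
  have htar := extChartAt_target_mem_nhds (I := 𝓡 n) x
  have hx := mem_extChartAt_target (I := 𝓡 n) x
  have hd : ∀ φ : C^∞⟮𝓡 n, M; ℝ⟯, ContinuousAt
      (fderiv ℝ (φ ∘ (extChartAt (𝓡 n) x).symm)) (extChartAt (𝓡 n) x x) := fun φ ↦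
    ((contDiffOn_chart φ x).continuousOn_fderiv_of_isOpen (isOpen_extChartAt_target x)
      (by simp)).continuousAt htar
  have hinv : ContinuousAt (fun e ↦ (chartForm g x e).inverse) (extChartAt (𝓡 n) x x) := by
    obtain ⟨L, hL⟩ := isInvertible_chartForm g x hx
    have h1 : ContinuousAt ContinuousLinearMap.inverse
        (chartForm g x (extChartAt (𝓡 n) x x)) := by
      rw [← hL]; exact (contDiffAt_map_inverse (𝕜 := ℝ) (n := 0) L).continuousAt
    exact ContinuousAt.comp (f := chartForm g x) h1 (continuousAt_chartForm g x)
  have h1 : ContinuousAt (fun e ↦ fderiv ℝ (φ ∘ (extChartAt (𝓡 n) x).symm) e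
      ((chartForm g x e).inverse (fderiv ℝ (ψ ∘ (extChartAt (𝓡 n) x).symm) e)))
      (extChartAt (𝓡 n) x x) := (hd φ).clm_apply (hinv.clm_apply (hd ψ))
  refine (ContinuousAt.comp (f := extChartAt (𝓡 n) x) h1 (continuousAt_extChartAt x)).congr ?_
  filter_upwards [extChartAt_source_mem_nhds (I := 𝓡 n) x] with y hy
  have h2 := cometric_mfderiv_eq g φ ψ x ((extChartAt (𝓡 n) x).map_source hy)
  have h3 := (extChartAt (𝓡 n) x).left_inv hy
  rw [Function.comp_apply, ← h2, h3]

lemma eventually_norm_lt_add_one {X F : Type*} [TopologicalSpace X] [NormedAddCommGroup F]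
    {f : X → F} {x : X} (hf : ContinuousAt f x) : ∀ᶠ y in 𝓝 x, ‖f y‖ < ‖f x‖ + 1 :=
  hf.norm.eventually (gt_mem_nhds (by linarith))

/-- Near the centre of a chart, the Euclidean norm of the differential of a function is controlled
by its Riemannian norm, and the volume density is bounded above and below. -/
lemma exists_chart_bounds (g : Metric n r M) (x : M) :
    ∃ ρ > 0, ∃ C > 0, Metric.ball (extChartAt (𝓡 n) x x) ρ ⊆ (extChartAt (𝓡 n) x).target ∧
      ∀ e ∈ Metric.ball (extChartAt (𝓡 n) x x) ρ,
        C⁻¹ ≤ chartDensity g x e ∧ chartDensity g x e ≤ C ∧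
        ∀ φ : C^∞⟮𝓡 n, M; ℝ⟯, ‖fderiv ℝ (φ ∘ (extChartAt (𝓡 n) x).symm) e‖ ^ 2 ≤
          C * cometric g ((extChartAt (𝓡 n) x).symm e)
            (mfderiv (𝓡 n) 𝓘(ℝ, ℝ) φ ((extChartAt (𝓡 n) x).symm e))
            (mfderiv (𝓡 n) 𝓘(ℝ, ℝ) φ ((extChartAt (𝓡 n) x).symm e)) := by
  have hform := continuousAt_chartForm g x
  have hdens : ContinuousAt (chartDensity g x) (extChartAt (𝓡 n) x x) := by
    have h1 : ContinuousAt (fun e ↦ (Matrix.of fun i l : Fin n ↦ chartForm g x e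
      (EuclideanSpace.single i 1) (EuclideanSpace.single l 1)).det) (extChartAt (𝓡 n) x x) := by
      refine ContinuousAt.comp (g := Matrix.det) (Continuous.matrix_det continuous_id).continuousAt ?_
      refine continuousAt_pi.2 fun i ↦ continuousAt_pi.2 fun l ↦ ?_
      exact (hform.clm_apply continuousAt_const).clm_apply continuousAt_const
    exact h1.sqrt
  have h3 := eventually_norm_lt_add_one
    (F := EuclideanSpace ℝ (Fin n) →L[ℝ] EuclideanSpace ℝ (Fin n) →L[ℝ] ℝ) hform
  have hpos := chartDensity_pos g x (mem_extChartAt_target (I := 𝓡 n) x)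
  set d := chartDensity g x (extChartAt (𝓡 n) x x) with hd
  set F := ‖chartForm g x (extChartAt (𝓡 n) x x)‖ with hF
  have h1 : ∀ᶠ e in 𝓝 (extChartAt (𝓡 n) x x), d / 2 < chartDensity g x e :=
    hdens.eventually (lt_mem_nhds (by linarith))
  have h2 : ∀ᶠ e in 𝓝 (extChartAt (𝓡 n) x x), chartDensity g x e < d + 1 :=
    hdens.eventually (gt_mem_nhds (by linarith))
  have h4 : ∀ᶠ e in 𝓝 (extChartAt (𝓡 n) x x), e ∈ (extChartAt (𝓡 n) x).target :=
    extChartAt_target_mem_nhds (I := 𝓡 n) x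
  obtain ⟨ρ, hρ, hball⟩ := Metric.eventually_nhds_iff_ball.1 (h1.and (h2.and (h3.and h4)))
  have hF0 : 0 ≤ F := ContinuousLinearMap.opNorm_nonneg _
  -- One summand for each bound near the centre: density above d/2, density below d + 1, norm of the
  -- metric below F + 1.
  set C := 2 / d + (d + 1) + (F + 1) with hC
  have hd2 : 0 < 2 / d := by positivity
  refine ⟨ρ, hρ, C, by positivity, fun e he ↦ (hball e he).2.2.2, fun e he ↦ ?_⟩
  obtain ⟨k1, k2, k3, k4⟩ := hball e he
  refine ⟨?_, by linarith, fun φ ↦ ?_⟩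
  · refine le_trans ?_ k1.le
    rw [inv_le_comm₀ (by positivity) (by positivity), inv_div]
    linarith
  · set N := cometric g ((extChartAt (𝓡 n) x).symm e)
            (mfderiv (𝓡 n) 𝓘(ℝ, ℝ) φ ((extChartAt (𝓡 n) x).symm e))
            (mfderiv (𝓡 n) 𝓘(ℝ, ℝ) φ ((extChartAt (𝓡 n) x).symm e)) with hN
    have hN0 : 0 ≤ N := cometric_self_nonneg g _ _
    have hC0 : 0 ≤ C := by positivity
    have h5 : ‖fderiv ℝ (φ ∘ (extChartAt (𝓡 n) x).symm) e‖ ≤ √(C * N) := by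
      refine ContinuousLinearMap.opNorm_le_bound _ (Real.sqrt_nonneg _) fun v ↦ ?_
      rw [fderiv_chart φ x k4, ← Real.sqrt_sq (norm_nonneg v), ← Real.sqrt_mul (by positivity)]
      refine Real.abs_le_sqrt ?_
      have h6 := sq_apply_le_cometric g ((extChartAt (𝓡 n) x).symm e)
        (mfderiv (𝓡 n) 𝓘(ℝ, ℝ) φ ((extChartAt (𝓡 n) x).symm e)) (symmDeriv x e v)
      have h7 : chartForm g x e v v ≤ C * ‖v‖ ^ 2 := by
        refine (Real.le_norm_self _).trans ((ContinuousLinearMap.le_opNorm₂ _ _ _).trans ?_)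
        rw [mul_assoc, ← pow_two]
        gcongr
        linarith
      calc _ ≤ N * chartForm g x e v v := h6
        _ ≤ N * (C * ‖v‖ ^ 2) := by gcongr
        _ = _ := by ring
    calc _ ≤ √(C * N) ^ 2 := by gcongr
      _ = _ := Real.sq_sqrt (by positivity)

end Cometric

/-! ### The Riemannian volume measure against Lebesgue measure in charts. -/

section Volume

variable {n : ℕ} {M : Type*} [TopologicalSpace M]
  [ChartedSpace (EuclideanSpace ℝ (Fin n)) M]

lemma isOpen_chart_ball (x : M) (ρ : ℝ) : IsOpen ((extChartAt (𝓡 n) x).source ∩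
    extChartAt (𝓡 n) x ⁻¹' Metric.ball (extChartAt (𝓡 n) x x) ρ) :=
  isOpen_extChartAt_preimage' x Metric.isOpen_ball

lemma mem_chart_ball (x : M) {ρ : ℝ} (hρ : 0 < ρ) : x ∈ (extChartAt (𝓡 n) x).source ∩
    extChartAt (𝓡 n) x ⁻¹' Metric.ball (extChartAt (𝓡 n) x x) ρ :=
  ⟨mem_extChartAt_source x, Metric.mem_ball_self hρ⟩

variable [MeasurableSpace M] [BorelSpace M]

lemma measurableSet_inter_preimage {X Y : Type*} [TopologicalSpace X] [MeasurableSpace X]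
    [OpensMeasurableSpace X] [TopologicalSpace Y] [MeasurableSpace Y] [BorelSpace Y] {f : X → Y}
    {s : Set X} {S : Set Y} (hf : ContinuousOn f s) (hs : MeasurableSet s)
    (hS : MeasurableSet S) : MeasurableSet (s ∩ f ⁻¹' S) := by
  have h1 : Measurable (s.domRestrict f) :=
    (continuousOn_iff_continuous_domRestrict.1 hf).measurable
  convert hs.subtype_image (h1 hS) using 1
  ext e
  simp [and_comm]

lemma measurableSet_target_inter (x : M) {s : Set (EuclideanSpace ℝ (Fin n))} {S : Set M}
    (hs : MeasurableSet s) (hst : s ⊆ (extChartAt (𝓡 n) x).target) (hS : MeasurableSet S) :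
    MeasurableSet (s ∩ (extChartAt (𝓡 n) x).symm ⁻¹' S) :=
  measurableSet_inter_preimage ((continuousOn_extChartAt_symm x).mono hst) hs hS

lemma aemeasurable_symm (x : M) {s : Set (EuclideanSpace ℝ (Fin n))} (hs : MeasurableSet s)
    (hst : s ⊆ (extChartAt (𝓡 n) x).target) :
    AEMeasurable (extChartAt (𝓡 n) x).symm (volume.restrict s) :=
  ((continuousOn_extChartAt_symm x).mono hst).aemeasurable hs

variable [IsManifold (𝓡 n) ∞ M] {r : WithTop ℕ∞}

lemma chartVolume_apply (g : Metric n r M) (x : M) {S : Set M} (hS : MeasurableSet S) :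
    chartVolume g x S = ∫⁻ e in (extChartAt (𝓡 n) x).target ∩ (extChartAt (𝓡 n) x).symm ⁻¹' S,
      ENNReal.ofReal (chartDensity g x e) := by
  have htar := (isOpen_extChartAt_target (I := 𝓡 n) x).measurableSet
  rw [chartVolume, Measure.map_apply_of_aemeasurable
    ((aemeasurable_symm x htar subset_rfl).mono_ac (withDensity_absolutelyContinuous _ _)) hS,
    withDensity_apply', Measure.restrict_restrict' htar, Set.inter_comm]

/-- The volumes of two charts agree on the overlap. -/
lemma chartVolume_le_of_subset (g : Metric n r M) (x y : M) {S : Set M} (hS : MeasurableSet S)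
    (hSx : S ⊆ (extChartAt (𝓡 n) x).source) : chartVolume g y S ≤ chartVolume g x S := by
  rw [chartVolume_apply g x hS, chartVolume_apply g y hS]
  set τ := extChartAt (𝓡 n) y ∘ (extChartAt (𝓡 n) x).symm with hτ
  set T := (extChartAt (𝓡 n) x).target ∩
    (extChartAt (𝓡 n) x).symm ⁻¹' (S ∩ (extChartAt (𝓡 n) y).source) with hT
  have hTm : MeasurableSet T :=
    measurableSet_target_inter x (isOpen_extChartAt_target x).measurableSet subset_rfl
      (hS.inter (isOpen_extChartAt_source y).measurableSet)
  have himg : τ '' T = (extChartAt (𝓡 n) y).target ∩ (extChartAt (𝓡 n) y).symm ⁻¹' S := by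
    ext e
    constructor
    · rintro ⟨e, ⟨-, h2, h3⟩, rfl⟩
      refine ⟨(extChartAt (𝓡 n) y).map_source h3, ?_⟩
      rw [Set.mem_preimage, hτ, Function.comp_apply, (extChartAt (𝓡 n) y).left_inv h3]
      exact h2
    · rintro ⟨h1, h2⟩
      have h3 : (extChartAt (𝓡 n) x).symm (extChartAt (𝓡 n) x ((extChartAt (𝓡 n) y).symm e)) =
          (extChartAt (𝓡 n) y).symm e := (extChartAt (𝓡 n) x).left_inv (hSx h2)
      refine ⟨extChartAt (𝓡 n) x ((extChartAt (𝓡 n) y).symm e),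
        ⟨(extChartAt (𝓡 n) x).map_source (hSx h2), ?_⟩, ?_⟩
      · rw [Set.mem_preimage, h3]
        exact ⟨h2, (extChartAt (𝓡 n) y).map_target h1⟩
      · rw [hτ, Function.comp_apply, h3, (extChartAt (𝓡 n) y).right_inv h1]
  have hinj : Set.InjOn τ T := by
    rintro e ⟨h1, -, h3⟩ e' ⟨h1', -, h3'⟩ h
    exact (extChartAt (𝓡 n) x).symm.injOn h1 h1' ((extChartAt (𝓡 n) y).injOn h3 h3' h)
  have hder : ∀ e ∈ T, HasFDerivAt τ (fderiv ℝ τ e) e ∧ chartDensity g x e =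
      |(fderiv ℝ τ e).det| * chartDensity g y (τ e) := by
    rintro e ⟨h1, -, h3⟩
    obtain ⟨τ', h4, h5⟩ := exists_transition g h1 h3
    rw [h4.fderiv]
    exact ⟨h4, h5⟩
  rw [← himg, lintegral_image_eq_lintegral_abs_det_fderiv_mul volume hTm
    (fun e he ↦ (hder e he).1.hasFDerivWithinAt) hinj]
  calc ∫⁻ e in T, ENNReal.ofReal |(fderiv ℝ τ e).det| * ENNReal.ofReal (chartDensity g y (τ e))
      = ∫⁻ e in T, ENNReal.ofReal (chartDensity g x e) := by
        refine setLIntegral_congr_fun hTm fun e he ↦ ?_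
        rw [← ENNReal.ofReal_mul (abs_nonneg _), ← (hder e he).2]
    _ ≤ _ := by
        refine lintegral_mono_set ?_
        exact Set.inter_subset_inter_right _ (Set.preimage_mono Set.inter_subset_left)

/-- A supremum of measures is not computed set by set. It is bounded here by an explicit upper bound
of the family: the volume of the chart at x on S, and the largest measure off S. -/
lemma vol_le_chartVolume (g : Metric n r M) (x : M) {S : Set M} (hS : MeasurableSet S)
    (hSx : S ⊆ (extChartAt (𝓡 n) x).source) : vol g S ≤ chartVolume g x S := by
  have hle : vol g ≤ (chartVolume g x).restrict S + (⊤ : Measure M).restrict Sᶜ := by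
    refine iSup_le fun y ↦ Measure.le_iff.2 fun A hA ↦ ?_
    rw [Measure.add_apply, Measure.restrict_apply hA, Measure.restrict_apply hA,
      ← measure_inter_add_sdiff A hS]
    refine add_le_add ?_ ?_
    · exact chartVolume_le_of_subset g x y (hA.inter hS) (Set.inter_subset_right.trans hSx)
    · exact (le_top : chartVolume g y ≤ ⊤) _
  refine (hle S).trans_eq ?_
  rw [Measure.add_apply, Measure.restrict_apply hS, Measure.restrict_apply hS, Set.inter_self,
    Set.inter_compl_self, measure_empty, add_zero]

/-- Near `x`, the Riemannian volume is comparable to the Lebesgue measure of the chart, and the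
Riemannian norm of differentials to the Euclidean norm. -/
lemma exists_good_chart (g : Metric n r M) (x : M) :
    ∃ ρ > 0, ∃ C : ℝ, 0 < C ∧ Metric.ball (extChartAt (𝓡 n) x x) ρ ⊆ (extChartAt (𝓡 n) x).target ∧
      (∀ e ∈ Metric.ball (extChartAt (𝓡 n) x x) ρ,
        ∀ φ : C^∞⟮𝓡 n, M; ℝ⟯, ‖fderiv ℝ (φ ∘ (extChartAt (𝓡 n) x).symm) e‖ ^ 2 ≤
          C * cometric g ((extChartAt (𝓡 n) x).symm e)
            (mfderiv (𝓡 n) 𝓘(ℝ, ℝ) φ ((extChartAt (𝓡 n) x).symm e))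
            (mfderiv (𝓡 n) 𝓘(ℝ, ℝ) φ ((extChartAt (𝓡 n) x).symm e))) ∧
      (volume.restrict (Metric.ball (extChartAt (𝓡 n) x x) ρ)).map (extChartAt (𝓡 n) x).symm ≤
        ENNReal.ofReal C • vol g ∧
      (vol g).restrict ((extChartAt (𝓡 n) x).source ∩
          extChartAt (𝓡 n) x ⁻¹' Metric.ball (extChartAt (𝓡 n) x x) ρ) ≤ ENNReal.ofReal C •
        (volume.restrict (Metric.ball (extChartAt (𝓡 n) x x) ρ)).map
          (extChartAt (𝓡 n) x).symm := by
  obtain ⟨ρ, hρ, C, hC, hball, hb⟩ := exists_chart_bounds g x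
  set B := Metric.ball (extChartAt (𝓡 n) x x) ρ with hB
  have hBm : MeasurableSet B := measurableSet_ball
  have hmap : ∀ S, MeasurableSet S → (volume.restrict B).map (extChartAt (𝓡 n) x).symm S =
      volume (B ∩ (extChartAt (𝓡 n) x).symm ⁻¹' S) := fun S hS ↦ by
    rw [Measure.map_apply_of_aemeasurable (aemeasurable_symm x hBm hball) hS,
      Measure.restrict_apply' hBm, Set.inter_comm]
  refine ⟨ρ, hρ, C, hC, hball, fun e he ↦ (hb e he).2.2, ?_, ?_⟩
  · refine Measure.le_iff.2 fun S hS ↦ ?_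
    rw [hmap S hS, Measure.smul_apply, smul_eq_mul]
    refine le_trans ?_ (mul_le_mul_right (le_iSup (fun x ↦ chartVolume g x) x S) _)
    rw [chartVolume_apply g x hS, ← lintegral_const_mul' _ _ ENNReal.ofReal_ne_top]
    calc volume (B ∩ (extChartAt (𝓡 n) x).symm ⁻¹' S)
        = ∫⁻ _ in B ∩ (extChartAt (𝓡 n) x).symm ⁻¹' S, 1 := by simp
      _ ≤ ∫⁻ e in B ∩ (extChartAt (𝓡 n) x).symm ⁻¹' S,
            ENNReal.ofReal C * ENNReal.ofReal (chartDensity g x e) := by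
          refine setLIntegral_mono' (measurableSet_target_inter x hBm hball hS) fun e he ↦ ?_
          rw [← ENNReal.ofReal_mul hC.le, ← ENNReal.ofReal_one]
          refine ENNReal.ofReal_le_ofReal ?_
          have h1 := (hb e he.1).1
          rwa [inv_le_iff_one_le_mul₀' hC] at h1
      _ ≤ _ := lintegral_mono_set (Set.inter_subset_inter_left _ hball)
  · set U := (extChartAt (𝓡 n) x).source ∩ extChartAt (𝓡 n) x ⁻¹' B with hU
    have hUm : MeasurableSet U := (isOpen_extChartAt_preimage' x Metric.isOpen_ball).measurableSet
    refine Measure.le_iff.2 fun S hS ↦ ?_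
    rw [Measure.restrict_apply hS, Measure.smul_apply, smul_eq_mul, hmap S hS]
    refine (vol_le_chartVolume g x (hS.inter hUm)
      (Set.inter_subset_right.trans Set.inter_subset_left)).trans ?_
    have hset : (extChartAt (𝓡 n) x).target ∩ (extChartAt (𝓡 n) x).symm ⁻¹' (S ∩ U) =
        B ∩ (extChartAt (𝓡 n) x).symm ⁻¹' S := by
      ext e
      constructor
      · rintro ⟨h1, h2, -, h3⟩
        rw [Set.mem_preimage, (extChartAt (𝓡 n) x).right_inv h1] at h3
        exact ⟨h3, h2⟩
      · rintro ⟨h1, h2⟩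
        refine ⟨hball h1, h2, (extChartAt (𝓡 n) x).map_target (hball h1), ?_⟩
        rwa [Set.mem_preimage, (extChartAt (𝓡 n) x).right_inv (hball h1)]
    rw [chartVolume_apply g x (hS.inter hUm), hset, ← setLIntegral_const]
    refine setLIntegral_mono' (measurableSet_target_inter x hBm hball hS) fun e he ↦ ?_
    exact ENNReal.ofReal_le_ofReal (hb e he.1).2.1

instance isFiniteMeasure_vol [CompactSpace M] (g : Metric n r M) : IsFiniteMeasure (vol g) := by
  refine ⟨isCompact_univ.measure_lt_top_of_nhdsWithin fun x _ ↦ ?_⟩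
  obtain ⟨ρ, hρ, C, hC, hball, -, -, hle⟩ := exists_good_chart g x
  refine ⟨_, mem_nhdsWithin_of_mem_nhds ((isOpen_chart_ball (n := n) x ρ).mem_nhds
    (mem_chart_ball x hρ)), ?_⟩
  have h1 := hle Set.univ
  rw [Measure.restrict_apply_univ, Measure.smul_apply,
    Measure.map_apply_of_aemeasurable (aemeasurable_symm x measurableSet_ball hball)
      MeasurableSet.univ, Set.preimage_univ, Measure.restrict_apply_univ] at h1
  exact h1.trans_lt (ENNReal.mul_lt_top ENNReal.ofReal_lt_top measure_ball_lt_top)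

instance isOpenPosMeasure_vol (g : Metric n r M) : (vol g).IsOpenPosMeasure := by
  refine ⟨fun V hV ⟨x, hx⟩ h0 ↦ ?_⟩
  obtain ⟨ρ, hρ, C, hC, hball, -, hle, -⟩ := exists_good_chart g x
  have h1 := hle V
  rw [Measure.smul_apply, h0, smul_zero, Measure.map_apply_of_aemeasurable
    (aemeasurable_symm x measurableSet_ball hball) hV.measurableSet,
    Measure.restrict_apply' measurableSet_ball, Set.inter_comm] at h1
  have h2 : IsOpen (Metric.ball (extChartAt (𝓡 n) x x) ρ ∩ (extChartAt (𝓡 n) x).symm ⁻¹' V) :=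
    ((continuousOn_extChartAt_symm x).mono hball).isOpen_inter_preimage Metric.isOpen_ball hV
  have h3 : (Metric.ball (extChartAt (𝓡 n) x x) ρ ∩
      (extChartAt (𝓡 n) x).symm ⁻¹' V).Nonempty :=
    ⟨extChartAt (𝓡 n) x x, Metric.mem_ball_self hρ, by
      rwa [Set.mem_preimage, extChartAt_to_inv]⟩
  exact (h2.measure_pos volume h3).ne' (le_antisymm h1 bot_le)

end Volume

/-! ### The Dirichlet form on smooth functions and its Poincaré inequality in a chart. -/

section Dirichlet

variable {n : ℕ} {M : Type*} [TopologicalSpace M] [CompactSpace M] [MeasurableSpace M]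
  [BorelSpace M] [ChartedSpace (EuclideanSpace ℝ (Fin n)) M]

lemma integrable_of_continuous {m : Measure M} [IsFiniteMeasure m] {f : M → ℝ}
    (hf : Continuous f) : Integrable f m :=
  hf.integrable_of_hasCompactSupport (HasCompactSupport.of_compactSpace f)

lemma lintegral_ofReal_eq {m : Measure M} [IsFiniteMeasure m] {f : M → ℝ} (hf : Continuous f)
    (h0 : ∀ x, 0 ≤ f x) : ∫⁻ x, ENNReal.ofReal (f x) ∂m = ENNReal.ofReal (∫ x, f x ∂m) :=
  (ofReal_integral_eq_lintegral_ofReal (integrable_of_continuous hf)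
    (Eventually.of_forall h0)).symm

lemma enorm_sq_eq_ofReal (a : ℝ) : ‖a‖ₑ ^ 2 = ENNReal.ofReal (a ^ 2) := by
  rw [← ofReal_norm, ← ENNReal.ofReal_pow (norm_nonneg _), Real.norm_eq_abs, sq_abs]

lemma memLp_smooth (m : Measure M) [IsFiniteMeasure m] (φ : C^∞⟮𝓡 n, M; ℝ⟯) : MemLp φ 2 m :=
  φ.contMDiff.continuous.memLp_of_hasCompactSupport (HasCompactSupport.of_compactSpace φ)

/-- Smooth functions, as elements of `L²`. -/
def toL2 (m : Measure M) [IsFiniteMeasure m] : C^∞⟮𝓡 n, M; ℝ⟯ →ₗ[ℝ] Lp ℝ 2 m where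
  toFun φ := (memLp_smooth m φ).toLp φ
  map_add' _ _ := rfl
  map_smul' _ _ := rfl

lemma coeFn_toL2 (m : Measure M) [IsFiniteMeasure m] (φ : C^∞⟮𝓡 n, M; ℝ⟯) :
    toL2 m φ =ᵐ[m] φ := (memLp_smooth m φ).coeFn_toLp

open scoped InnerProductSpace in
lemma inner_toL2 (m : Measure M) [IsFiniteMeasure m] (u : Lp ℝ 2 m) (φ : C^∞⟮𝓡 n, M; ℝ⟯) :
    ⟪u, toL2 m φ⟫_ℝ = ∫ x, u x * φ x ∂m := by
  rw [L2.inner_def]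
  refine integral_congr_ae ?_
  filter_upwards [coeFn_toL2 m φ] with x hx
  simp [hx, mul_comm]

lemma norm_toL2_sub_sq (m : Measure M) [IsFiniteMeasure m] (φ : C^∞⟮𝓡 n, M; ℝ⟯) (c : ℝ) :
    ‖toL2 m φ - c • toL2 (n := n) m 1‖ ^ 2 = ∫ x, (φ x - c) ^ 2 ∂m := by
  rw [← map_smul, ← map_sub, ← real_inner_self_eq_norm_sq, inner_toL2]
  refine integral_congr_ae ?_
  filter_upwards [coeFn_toL2 m (φ - c • 1 : C^∞⟮𝓡 n, M; ℝ⟯)] with x hx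
  rw [hx]
  simp [pow_two]

lemma norm_toL2_sq (m : Measure M) [IsFiniteMeasure m] (φ : C^∞⟮𝓡 n, M; ℝ⟯) :
    ‖toL2 m φ‖ ^ 2 = ∫ x, φ x ^ 2 ∂m := by
  have := norm_toL2_sub_sq m φ 0
  simpa using this

variable [IsManifold (𝓡 n) ∞ M] {r : WithTop ℕ∞}

lemma modelDeriv_add (φ ψ : C^∞⟮𝓡 n, M; ℝ⟯) (p : M) :
    modelDeriv (φ + ψ) p = modelDeriv φ p + modelDeriv ψ p :=
  mfderiv_add (φ.contMDiff.mdifferentiable (by simp) p) (ψ.contMDiff.mdifferentiable (by simp) p)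

lemma modelDeriv_smul (c : ℝ) (φ : C^∞⟮𝓡 n, M; ℝ⟯) (p : M) :
    modelDeriv (c • φ) p = c • modelDeriv φ p :=
  const_smul_mfderiv (φ.contMDiff.mdifferentiable (by simp) p) c

lemma dirichlet_add (g : Metric n r M) (φ φ' ψ : C^∞⟮𝓡 n, M; ℝ⟯) :
    dirichlet g (φ + φ') ψ = dirichlet g φ ψ + dirichlet g φ' ψ := by
  rw [dirichlet, dirichlet, dirichlet, ← integral_add
    (integrable_of_continuous (continuous_cometric_mfderiv g φ ψ))
    (integrable_of_continuous (continuous_cometric_mfderiv g φ' ψ))]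
  refine integral_congr_ae (Eventually.of_forall fun x ↦ ?_)
  exact (congrArg (fun α ↦ cometric g x α (modelDeriv ψ x)) (modelDeriv_add φ φ' x)).trans
    (cometric_add_left g x _ _ _)

lemma dirichlet_smul (g : Metric n r M) (c : ℝ) (φ ψ : C^∞⟮𝓡 n, M; ℝ⟯) :
    dirichlet g (c • φ) ψ = c • dirichlet g φ ψ := by
  rw [dirichlet, dirichlet, smul_eq_mul, ← integral_const_mul]
  refine integral_congr_ae (Eventually.of_forall fun x ↦ ?_)
  exact (congrArg (fun α ↦ cometric g x α (modelDeriv ψ x)) (modelDeriv_smul c φ x)).trans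
    (cometric_smul_left g x _ _ _)

lemma dirichlet_symm (g : Metric n r M) (φ ψ : C^∞⟮𝓡 n, M; ℝ⟯) :
    dirichlet g φ ψ = dirichlet g ψ φ :=
  integral_congr_ae (Eventually.of_forall fun x ↦ cometric_symm g x _ _)

/-- The Dirichlet form as a bilinear form. -/
def dirichletForm (g : Metric n r M) : LinearMap.BilinForm ℝ C^∞⟮𝓡 n, M; ℝ⟯ :=
  LinearMap.mk₂ ℝ (dirichlet g) (dirichlet_add g) (dirichlet_smul g)
    (fun φ ψ ψ' ↦ by
      rw [dirichlet_symm, dirichlet_add, dirichlet_symm g ψ, dirichlet_symm g ψ'])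
    (fun c φ ψ ↦ by rw [dirichlet_symm, dirichlet_smul, dirichlet_symm g ψ])

lemma dirichletForm_apply (g : Metric n r M) (φ ψ : C^∞⟮𝓡 n, M; ℝ⟯) :
    dirichletForm g φ ψ = dirichlet g φ ψ := rfl

lemma dirichletForm_symm (g : Metric n r M) (φ ψ : C^∞⟮𝓡 n, M; ℝ⟯) :
    dirichletForm g φ ψ = dirichletForm g ψ φ :=
  dirichlet_symm g φ ψ

lemma dirichletForm_nonneg (g : Metric n r M) (φ : C^∞⟮𝓡 n, M; ℝ⟯) : 0 ≤ dirichletForm g φ φ :=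
  integral_nonneg fun x ↦ cometric_self_nonneg g x _

lemma lintegral_cometric (g : Metric n r M) (φ : C^∞⟮𝓡 n, M; ℝ⟯) :
    ∫⁻ x, ENNReal.ofReal (cometric g x (mfderiv (𝓡 n) 𝓘(ℝ, ℝ) φ x)
      (mfderiv (𝓡 n) 𝓘(ℝ, ℝ) φ x)) ∂(vol g) = ENNReal.ofReal (dirichletForm g φ φ) :=
  lintegral_ofReal_eq (continuous_cometric_mfderiv g φ φ) fun x ↦ cometric_self_nonneg g x _

lemma isWeakEigenfunction_iff (g : Metric n r M) (μ : ℝ) (u : Lp ℝ 2 (vol g)) :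
    IsWeakEigenfunction g μ u ↔ IsFormEigenvector (toL2 (vol g)) (dirichletForm g) μ u := by
  have h1 : ∀ φ : ℕ → C^∞⟮𝓡 n, M; ℝ⟯,
      Tendsto (fun j ↦ eLpNorm (fun x ↦ u x - φ j x) 2 (vol g)) atTop (𝓝 0) ↔
      Tendsto (fun j ↦ toL2 (vol g) (φ j)) atTop (𝓝 u) := by
    intro φ
    rw [Lp.tendsto_Lp_iff_tendsto_eLpNorm']
    refine tendsto_congr fun j ↦ ?_
    rw [eLpNorm_sub_comm]
    refine eLpNorm_congr_ae ?_
    filter_upwards [coeFn_toL2 (vol g) (φ j)] with x hx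
    simp [hx]
  simp only [IsWeakEigenfunction, IsFormEigenvector, h1, inner_toL2, dirichletForm_apply]

lemma eigenvalue_eq (g : Metric n r M) (k : ℕ) :
    eigenvalue g k = sInf {t | HasEigenvectors (toL2 (vol g)) (dirichletForm g) k t} := by
  simp only [eigenvalue, HasEigenvectors, isWeakEigenfunction_iff]

/-- The Poincaré inequality on a convex subset of a good chart. -/
lemma exists_poincare_piece (g : Metric n r M) (x : M) :
    ∃ ρ > 0, ∃ C : ℝ, 0 < C ∧ ∀ (A : Set (EuclideanSpace ℝ (Fin n))) (d : ℝ),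
      A ⊆ Metric.ball (extChartAt (𝓡 n) x x) ρ → Convex ℝ A → MeasurableSet A → 0 ≤ d →
      (∀ e ∈ A, ∀ e' ∈ A, ‖e - e'‖ ≤ d) → ∀ φ : C^∞⟮𝓡 n, M; ℝ⟯, ∃ c : ℝ,
        ∫⁻ p in (extChartAt (𝓡 n) x).source ∩ extChartAt (𝓡 n) x ⁻¹' A, ‖φ p - c‖ₑ ^ 2 ∂(vol g) ≤
          ENNReal.ofReal (C * d ^ 2) *
          ∫⁻ p in (extChartAt (𝓡 n) x).source ∩ extChartAt (𝓡 n) x ⁻¹' A,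
            ENNReal.ofReal (cometric g p (mfderiv (𝓡 n) 𝓘(ℝ, ℝ) φ p)
              (mfderiv (𝓡 n) 𝓘(ℝ, ℝ) φ p)) ∂(vol g) := by
  obtain ⟨ρ, hρ, C, hC, hball, hgrad, hlow, hup⟩ := exists_good_chart g x
  -- One factor C for passing from volume to Lebesgue measure, one for the norm of the differential
  -- and one for the way back; 2^n d² is the Euclidean constant.
  refine ⟨ρ, hρ, C ^ 3 * 2 ^ n, by positivity, fun A d hAB hA hAm hd0 hd φ ↦ ?_⟩
  set B := Metric.ball (extChartAt (𝓡 n) x x) ρ with hB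
  have hBm : MeasurableSet B := measurableSet_ball
  have hAtar := hAB.trans hball
  set S := (extChartAt (𝓡 n) x).source ∩ extChartAt (𝓡 n) x ⁻¹' A with hS
  have hSm : MeasurableSet S := measurableSet_inter_preimage (continuousOn_extChartAt x)
    (isOpen_extChartAt_source x).measurableSet hAm
  have hBS : B ∩ (extChartAt (𝓡 n) x).symm ⁻¹' S = A := by
    ext e
    constructor
    · rintro ⟨h1, -, h2⟩
      rwa [Set.mem_preimage, (extChartAt (𝓡 n) x).right_inv (hball h1)] at h2
    · intro h1
      refine ⟨hAB h1, (extChartAt (𝓡 n) x).map_target (hAtar h1), ?_⟩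
      rwa [Set.mem_preimage, (extChartAt (𝓡 n) x).right_inv (hAtar h1)]
  set m := (volume.restrict B).map (extChartAt (𝓡 n) x).symm with hm
  have hsymm := aemeasurable_symm (n := n) x hBm hball
  have hint : ∀ F : M → ℝ≥0∞, Measurable F →
      ∫⁻ p in S, F p ∂m = ∫⁻ e in A, F ((extChartAt (𝓡 n) x).symm e) := by
    intro F hF
    rw [hm, Measure.restrict_map_of_aemeasurable hsymm hSm, lintegral_map' hF.aemeasurable
      (hsymm.mono_measure Measure.restrict_le_self),
      Measure.restrict_restrict' hBm, Set.inter_comm, hBS]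
  obtain ⟨c, hc⟩ := exists_poincare_of_convex volume hA hAm
    ((measure_mono hAB).trans_lt measure_ball_lt_top).ne (isOpen_extChartAt_target x) hAtar hd
    ((contDiffOn_chart φ x).of_le (by simp))
  refine ⟨c, ?_⟩
  have hφc : Continuous φ := φ.contMDiff.continuous
  set Q : M → ℝ := fun p ↦ cometric g p (mfderiv (𝓡 n) 𝓘(ℝ, ℝ) φ p)
    (mfderiv (𝓡 n) 𝓘(ℝ, ℝ) φ p) with hQ
  have hQc : Continuous Q := continuous_cometric_mfderiv g φ φ
  have hresU : (vol g).restrict S ≤ ENNReal.ofReal C • m.restrict S := by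
    rw [← Measure.restrict_smul]
    have h1 := Measure.restrict_mono_measure hup S
    rwa [Measure.restrict_restrict hSm, Set.inter_eq_left.2
      (Set.inter_subset_inter_right _ (Set.preimage_mono hAB))] at h1
  calc ∫⁻ p in S, ‖φ p - c‖ₑ ^ 2 ∂(vol g)
      ≤ ENNReal.ofReal C * ∫⁻ p in S, ‖φ p - c‖ₑ ^ 2 ∂m := by
        rw [← smul_eq_mul, ← lintegral_smul_measure]
        exact lintegral_mono' hresU le_rfl
    _ = ENNReal.ofReal C * ∫⁻ e in A, ‖(φ ∘ (extChartAt (𝓡 n) x).symm) e - c‖ₑ ^ 2 := by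
        rw [hint _ (by fun_prop)]; rfl
    _ ≤ ENNReal.ofReal C * (ENNReal.ofReal d ^ 2 * 2 ^ n * ∫⁻ e in A,
          ENNReal.ofReal C * ENNReal.ofReal (Q ((extChartAt (𝓡 n) x).symm e))) := by
        gcongr
        refine hc.trans ?_
        rw [finrank_euclideanSpace_fin]
        refine mul_le_mul_right ?_ _
        refine setLIntegral_mono' hAm fun e he ↦ ?_
        rw [← ENNReal.ofReal_mul hC.le, ← ofReal_norm, ← ENNReal.ofReal_pow (norm_nonneg _)]
        exact ENNReal.ofReal_le_ofReal (hgrad e (hAB he) φ)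
    _ = ENNReal.ofReal C * (ENNReal.ofReal d ^ 2 * 2 ^ n * (ENNReal.ofReal C *
          ∫⁻ p in S, ENNReal.ofReal (Q p) ∂m)) := by
        rw [lintegral_const_mul' _ _ ENNReal.ofReal_ne_top, hint _ (by fun_prop)]
    _ ≤ ENNReal.ofReal C * (ENNReal.ofReal d ^ 2 * 2 ^ n * (ENNReal.ofReal C *
          (ENNReal.ofReal C * ∫⁻ p in S, ENNReal.ofReal (Q p) ∂(vol g)))) := by
        refine mul_le_mul_right (mul_le_mul_right (mul_le_mul_right ?_ _) _) _
        rw [← smul_eq_mul, ← lintegral_smul_measure, ← Measure.restrict_smul]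
        exact lintegral_mono' (Measure.restrict_mono_measure hlow S) le_rfl
    _ = _ := by
        have h2 : (2 : ℝ≥0∞) ^ n = ENNReal.ofReal (2 ^ n) := by
          rw [ENNReal.ofReal_pow (by norm_num)]; norm_num
        rw [h2, ← ENNReal.ofReal_pow hd0, ← mul_assoc, ← mul_assoc, ← mul_assoc, ← mul_assoc]
        congr 1
        rw [← ENNReal.ofReal_mul (by positivity), ← ENNReal.ofReal_mul (by positivity),
          ← ENNReal.ofReal_mul (by positivity), ← ENNReal.ofReal_mul (by positivity)]
        congr 1
        ring

end Dirichlet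

universe u

lemma infinite_of_pos {n : ℕ} {M : Type*} [TopologicalSpace M]
    [ChartedSpace (EuclideanSpace ℝ (Fin n)) M] (hn : 1 ≤ n) [Nonempty M] : Infinite M := by
  obtain ⟨x⟩ : Nonempty M := inferInstance
  have : Nonempty (Fin n) := ⟨⟨0, hn⟩⟩
  have h1 : (extChartAt (𝓡 n) x).target.Infinite :=
    infinite_of_mem_nhds _ (extChartAt_target_mem_nhds (I := 𝓡 n) x)
  have h2 := h1.image (extChartAt (𝓡 n) x).symm.injOn
  exact Set.infinite_univ_iff.1 (h2.mono (Set.subset_univ _))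

/-! ### From charts to M: Rellich's theorem and the global Poincaré inequality. -/

section Global

variable {n : ℕ} {M : Type u} [TopologicalSpace M] [CompactSpace M] [MeasurableSpace M]
  [BorelSpace M] [ChartedSpace (EuclideanSpace ℝ (Fin n)) M] [IsManifold (𝓡 n) ∞ M]
  {r : WithTop ℕ∞}

lemma lintegral_enorm_sub_sq (m : Measure M) [IsFiniteMeasure m] (φ : C^∞⟮𝓡 n, M; ℝ⟯) (c : ℝ) :
    ∫⁻ p, ‖φ p - c‖ₑ ^ 2 ∂m = ENNReal.ofReal (∫ p, (φ p - c) ^ 2 ∂m) := by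
  simp only [enorm_sq_eq_ofReal]
  have hφ : Continuous φ := φ.contMDiff.continuous
  exact lintegral_ofReal_eq (by fun_prop) fun p ↦ sq_nonneg _

lemma exists_local_poincare (g : Metric n r M) (x : M) :
    ∃ U : Set M, IsOpen U ∧ x ∈ U ∧ ∃ C : ℝ, ∀ φ : C^∞⟮𝓡 n, M; ℝ⟯, ∃ c : ℝ,
      ∫ p in U, (φ p - c) ^ 2 ∂(vol g) ≤ C * dirichletForm g φ φ := by
  obtain ⟨ρ, hρ, C, hC, h⟩ := exists_poincare_piece g x
  refine ⟨_, isOpen_chart_ball (n := n) x ρ, mem_chart_ball (n := n) x hρ, C * (2 * ρ) ^ 2, fun φ ↦ ?_⟩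
  obtain ⟨c, hc⟩ := h _ (2 * ρ) subset_rfl (convex_ball _ _) measurableSet_ball (by positivity)
    (fun e he e' he' ↦ by
      rw [← dist_eq_norm]
      have h1 := dist_triangle_right e e' (extChartAt (𝓡 n) x x)
      rw [Metric.mem_ball] at he he'
      linarith) φ
  refine ⟨c, ?_⟩
  have h2 := hc.trans (mul_le_mul_right ((setLIntegral_le_lintegral _ _).trans_eq
    (lintegral_cometric g φ)) _)
  rw [lintegral_enorm_sub_sq, ← ENNReal.ofReal_mul (by positivity)] at h2
  exact (ENNReal.ofReal_le_ofReal_iff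
    (mul_nonneg (by positivity) (dirichletForm_nonneg g φ))).1 h2

/-- Pieces of diameter √(ε/C) have Poincaré constant ε, and being disjoint they share the energy
without overcounting. U must not depend on ε, so that a finite subcover can be fixed before ε is
divided by its size. -/
lemma exists_local_partition (g : Metric n r M) (x : M) :
    ∃ U : Set M, IsOpen U ∧ x ∈ U ∧ ∀ ε > 0, ∃ (κ : Type) (_ : Fintype κ) (A : κ → Set M),
      (∀ i, MeasurableSet (A i)) ∧ U ⊆ ⋃ i, A i ∧ ∀ φ : C^∞⟮𝓡 n, M; ℝ⟯, ∃ c : κ → ℝ,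
        ∑ i, ∫ p in A i, (φ p - c i) ^ 2 ∂(vol g) ≤ ε * dirichletForm g φ φ := by
  obtain ⟨ρ, hρ, C, hC, h⟩ := exists_poincare_piece g x
  refine ⟨_, isOpen_chart_ball (n := n) x ρ, mem_chart_ball (n := n) x hρ, fun ε hε ↦ ?_⟩
  have hδ : 0 < √(ε / C) := by positivity
  obtain ⟨κ, _, A, hA, hAm, hAd, hdisj, hun⟩ := exists_convex_partition
    (convex_ball (extChartAt (𝓡 n) x x) ρ) measurableSet_ball Metric.isBounded_ball hδ
  have hSm : ∀ i, MeasurableSet ((extChartAt (𝓡 n) x).source ∩ extChartAt (𝓡 n) x ⁻¹' A i) :=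
    fun i ↦ measurableSet_inter_preimage (continuousOn_extChartAt x)
      (isOpen_extChartAt_source x).measurableSet (hAm i)
  refine ⟨κ, inferInstance, fun i ↦ (extChartAt (𝓡 n) x).source ∩ extChartAt (𝓡 n) x ⁻¹' A i,
    hSm, ?_, fun φ ↦ ?_⟩
  · rw [← hun, Set.preimage_iUnion, Set.inter_iUnion]
  · choose c hc using fun i ↦ h (A i) _ (by rw [← hun]; exact Set.subset_iUnion A i) (hA i) (hAm i)
      hδ.le (hAd i) φ
    refine ⟨c, ?_⟩
    have hCε : C * √(ε / C) ^ 2 = ε := by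
      rw [Real.sq_sqrt (by positivity)]; field_simp
    rw [hCε] at hc
    rw [← ENNReal.ofReal_le_ofReal_iff (mul_nonneg hε.le (dirichletForm_nonneg g φ)),
      ENNReal.ofReal_sum_of_nonneg fun i _ ↦ integral_nonneg fun p ↦ sq_nonneg _]
    calc ∑ i, ENNReal.ofReal (∫ p in (extChartAt (𝓡 n) x).source ∩ extChartAt (𝓡 n) x ⁻¹' A i,
          (φ p - c i) ^ 2 ∂(vol g))
        ≤ ∑ i, ENNReal.ofReal ε *
          ∫⁻ p in (extChartAt (𝓡 n) x).source ∩ extChartAt (𝓡 n) x ⁻¹' A i,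
            ENNReal.ofReal (cometric g p (mfderiv (𝓡 n) 𝓘(ℝ, ℝ) φ p)
              (mfderiv (𝓡 n) 𝓘(ℝ, ℝ) φ p)) ∂(vol g) := by
          refine Finset.sum_le_sum fun i _ ↦ ?_
          rw [← lintegral_enorm_sub_sq]
          exact hc i
      _ = ENNReal.ofReal ε * ∫⁻ p in ⋃ i, (extChartAt (𝓡 n) x).source ∩ extChartAt (𝓡 n) x ⁻¹' A i,
            ENNReal.ofReal (cometric g p (mfderiv (𝓡 n) 𝓘(ℝ, ℝ) φ p)
              (mfderiv (𝓡 n) 𝓘(ℝ, ℝ) φ p)) ∂(vol g) := by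
          rw [← Finset.mul_sum, lintegral_iUnion hSm, tsum_fintype]
          intro i l hil
          exact ((hdisj hil).preimage _).mono Set.inter_subset_right Set.inter_subset_right
      _ ≤ ENNReal.ofReal ε * ENNReal.ofReal (dirichletForm g φ φ) := by
          rw [← lintegral_cometric]
          exact mul_le_mul_right (setLIntegral_le_lintegral _ _) _
      _ = _ := (ENNReal.ofReal_mul hε.le).symm

lemma exists_partition (g : Metric n r M) {ε : ℝ} (hε : 0 < ε) :
    ∃ (κ : Type u) (_ : Fintype κ) (A : κ → Set M),
      (∀ i, MeasurableSet (A i)) ∧ ⋃ i, A i = Set.univ ∧ ∀ φ : C^∞⟮𝓡 n, M; ℝ⟯, ∃ c : κ → ℝ,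
        ∑ i, ∫ p in A i, (φ p - c i) ^ 2 ∂(vol g) ≤ ε * dirichletForm g φ φ := by
  choose U hUo hxU h using fun x ↦ exists_local_partition g x
  obtain ⟨t, ht⟩ := isCompact_univ.elim_finite_subcover U hUo
    fun x _ ↦ Set.mem_iUnion.2 ⟨x, hxU x⟩
  have hε' : 0 < ε / (t.card + 1) := by positivity
  choose κ hκ A hA hUA hφ using fun x ↦ h x _ hε'
  refine ⟨Σ x : t, κ x, inferInstance, fun i ↦ A i.1 i.2, fun i ↦ hA _ _, ?_, fun φ ↦ ?_⟩
  · refine Set.eq_univ_of_univ_subset (ht.trans (Set.iUnion₂_subset fun x hx ↦ ?_))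
    refine (hUA x).trans (Set.iUnion_subset fun i ↦ ?_)
    exact Set.subset_iUnion (fun i : Σ x : t, κ x ↦ A i.1 i.2) ⟨⟨x, hx⟩, i⟩
  · choose c hc using fun x ↦ hφ x φ
    refine ⟨fun i ↦ c i.1 i.2, ?_⟩
    rw [Fintype.sum_sigma]
    refine (Finset.sum_le_sum fun (x : t) _ ↦ hc (x : M)).trans ?_
    have hD := dirichletForm_nonneg g φ
    rw [Finset.sum_const, Finset.card_univ, Fintype.card_coe, nsmul_eq_mul, ← mul_assoc]
    refine mul_le_mul_of_nonneg_right ?_ hD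
    rw [mul_div_assoc', div_le_iff₀ (by positivity)]
    nlinarith

open scoped InnerProductSpace in
/-- The Rellich theorem, in the form: the energy controls the `L²`-norm up to finitely many
functionals. -/
lemma isCompactForm_dirichletForm (g : Metric n r M) :
    IsCompactForm (toL2 (vol g)) (dirichletForm g) := by
  intro ε hε
  obtain ⟨κ, _, A, hA, hun, h⟩ := exists_partition g hε
  -- Indicators normalised in L², so that ⟨w i, φ⟩² is the squared norm of the piecewise mean of φ
  -- on A i; for a null piece w i = 0.
  let w : κ → Lp ℝ 2 (vol g) := fun i ↦
    (√((vol g).real (A i)))⁻¹ • indicatorConstLp 2 (hA i) (measure_ne_top _ _) (1 : ℝ)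
  have hw : ∀ i (φ : C^∞⟮𝓡 n, M; ℝ⟯), ⟪w i, toL2 (vol g) φ⟫_ℝ ^ 2 =
      (∫ p in A i, φ p ∂(vol g)) ^ 2 / (vol g).real (A i) := by
    intro i φ
    have h1 : ∫ p in A i, toL2 (vol g) φ p ∂(vol g) = ∫ p in A i, φ p ∂(vol g) :=
      integral_congr_ae (ae_restrict_of_ae (coeFn_toL2 _ φ))
    rw [real_inner_smul_left, L2.inner_indicatorConstLp_one, h1, mul_pow, inv_pow,
      Real.sq_sqrt measureReal_nonneg, div_eq_inv_mul]
  refine ⟨Fintype.card κ, fun i ↦ w ((Fintype.equivFin κ).symm i), fun φ ↦ ?_⟩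
  obtain ⟨c, hc⟩ := h φ
  have hφ : Continuous φ := φ.contMDiff.continuous
  rw [Equiv.sum_comp (Fintype.equivFin κ).symm fun i ↦ ⟪w i, toL2 (vol g) φ⟫_ℝ ^ 2, norm_toL2_sq]
  have hcover : ∫ p, φ p ^ 2 ∂(vol g) ≤ ∑ i, ∫ p in A i, φ p ^ 2 ∂(vol g) := by
    have h1 : ∀ m : Measure M, IsFiniteMeasure m →
        ENNReal.ofReal (∫ p, φ p ^ 2 ∂m) = ∫⁻ p, ‖φ p‖ₑ ^ 2 ∂m := fun m _ ↦ by
      simpa using (lintegral_enorm_sub_sq m φ 0).symm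
    rw [← ENNReal.ofReal_le_ofReal_iff
        (Finset.sum_nonneg fun i _ ↦ integral_nonneg fun p ↦ sq_nonneg _),
      ENNReal.ofReal_sum_of_nonneg fun i _ ↦ integral_nonneg fun p ↦ sq_nonneg _]
    simp only [h1 _ inferInstance]
    rw [← setLIntegral_univ, ← hun]
    exact (lintegral_iUnion_le _ _).trans_eq (tsum_fintype _)
  -- The mean is the best constant: after subtraction the gap is the square (∫φ - c vol(A i))²/vol(A
  -- i).
  have hpiece : ∀ i, ∫ p in A i, φ p ^ 2 ∂(vol g) ≤ ∫ p in A i, (φ p - c i) ^ 2 ∂(vol g) +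
      (∫ p in A i, φ p ∂(vol g)) ^ 2 / (vol g).real (A i) := by
    intro i
    have h1 : ∫ p in A i, (φ p - c i) ^ 2 ∂(vol g) = ∫ p in A i, φ p ^ 2 ∂(vol g) -
        2 * c i * ∫ p in A i, φ p ∂(vol g) + c i ^ 2 * (vol g).real (A i) := by
      have h2 : ∀ p, (φ p - c i) ^ 2 = φ p ^ 2 - 2 * c i * φ p + c i ^ 2 := fun p ↦ by ring
      simp only [h2]
      rw [integral_add (integrable_of_continuous (by fun_prop))
        (integrable_of_continuous (by fun_prop)),
        integral_sub (integrable_of_continuous (by fun_prop))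
        (integrable_of_continuous (by fun_prop)), integral_const_mul, integral_const]
      simp [mul_comm]
    rcases (measureReal_nonneg (μ := vol g) (s := A i)).eq_or_lt with h0 | h0
    · have h3 : (vol g).restrict (A i) = 0 := by
        rw [Measure.restrict_eq_zero]
        exact (measureReal_eq_zero_iff).1 h0.symm
      simp [h3]
    · rw [h1]
      have h4 : 0 ≤ ((∫ p in A i, φ p ∂(vol g)) - c i * (vol g).real (A i)) ^ 2 /
          (vol g).real (A i) := by positivity
      have h5 : ((∫ p in A i, φ p ∂(vol g)) - c i * (vol g).real (A i)) ^ 2 /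
          (vol g).real (A i) = (∫ p in A i, φ p ∂(vol g)) ^ 2 / (vol g).real (A i) -
            2 * c i * (∫ p in A i, φ p ∂(vol g)) + c i ^ 2 * (vol g).real (A i) := by
        field_simp; ring
      linarith
  calc _ ≤ ∑ i, ∫ p in A i, φ p ^ 2 ∂(vol g) := hcover
    _ ≤ ∑ i, (∫ p in A i, (φ p - c i) ^ 2 ∂(vol g) +
      (∫ p in A i, φ p ∂(vol g)) ^ 2 / (vol g).real (A i)) := Finset.sum_le_sum fun i _ ↦ hpiece i
    _ ≤ _ := by
      rw [Finset.sum_add_distrib]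
      simp only [hw]
      linarith

/-- The Poincaré inequality holds on `A`. -/
def HasPoincare (g : Metric n r M) (A : Set M) : Prop :=
  ∃ C : ℝ, ∀ φ : C^∞⟮𝓡 n, M; ℝ⟯, ∃ c : ℝ,
    ∫ p in A, (φ p - c) ^ 2 ∂(vol g) ≤ C * dirichletForm g φ φ

/-- The overlap is open and nonempty, so it has positive volume a, and there (c - c')² ≤ 2(φ - c)² +
2(φ - c')² bounds c - c' by the energy. The constant c can then be used on both sets. -/
lemma HasPoincare.union {g : Metric n r M} {A A' : Set M} (hA : IsOpen A) (hA' : IsOpen A')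
    (hAA : (A ∩ A').Nonempty) (h : HasPoincare g A) (h' : HasPoincare g A') :
    HasPoincare g (A ∪ A') := by
  obtain ⟨C, h⟩ := h
  obtain ⟨C', h'⟩ := h'
  set a := (vol g).real (A ∩ A') with ha
  have ha0 : 0 < a := by
    rw [ha, measureReal_def]
    exact ENNReal.toReal_pos ((hA.inter hA').measure_pos _ hAA).ne' (measure_ne_top _ _)
  set b := (vol g).real A' with hb
  refine ⟨C + 2 * C' + 2 * (b * ((2 * C + 2 * C') / a)), fun φ ↦ ?_⟩
  obtain ⟨c, hc⟩ := h φ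
  obtain ⟨c', hc'⟩ := h' φ
  have hφ : Continuous φ := φ.contMDiff.continuous
  have hi : ∀ (d : ℝ) (S : Set M), Integrable (fun p ↦ (φ p - d) ^ 2) ((vol g).restrict S) :=
    fun d S ↦ integrable_of_continuous (by fun_prop)
  have hmono : ∀ (d : ℝ) {S S' : Set M}, S ⊆ S' →
      ∫ p in S, (φ p - d) ^ 2 ∂(vol g) ≤ ∫ p in S', (φ p - d) ^ 2 ∂(vol g) := fun d S S' hS ↦
    integral_mono_measure (Measure.restrict_mono hS le_rfl)
      (Eventually.of_forall fun p ↦ sq_nonneg _) (hi d S')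
  have hcc : (c - c') ^ 2 * a ≤ (2 * C + 2 * C') * dirichletForm g φ φ := by
    have h1 : ∫ p in A ∩ A', (c - c') ^ 2 ∂(vol g) ≤
        ∫ p in A ∩ A', (2 * (φ p - c) ^ 2 + 2 * (φ p - c') ^ 2) ∂(vol g) := by
      refine integral_mono (integrable_const _)
        (((hi c _).const_mul 2).add ((hi c' _).const_mul 2)) fun p ↦ ?_
      change (c - c') ^ 2 ≤ 2 * (φ p - c) ^ 2 + 2 * (φ p - c') ^ 2
      nlinarith [sq_nonneg (φ p - c + (φ p - c'))]
    rw [integral_add ((hi c _).const_mul 2) ((hi c' _).const_mul 2), integral_const_mul,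
      integral_const_mul, setIntegral_const, smul_eq_mul] at h1
    have h2 := hmono c (Set.inter_subset_left : A ∩ A' ⊆ A)
    have h3 := hmono c' (Set.inter_subset_right : A ∩ A' ⊆ A')
    nlinarith
  have hA'c : ∫ p in A', (φ p - c) ^ 2 ∂(vol g) ≤
      2 * (C' * dirichletForm g φ φ) + 2 * ((c - c') ^ 2 * b) := by
    have h1 : ∫ p in A', (φ p - c) ^ 2 ∂(vol g) ≤
        ∫ p in A', (2 * (φ p - c') ^ 2 + 2 * (c - c') ^ 2) ∂(vol g) := by
      refine integral_mono (hi c _) (((hi c' _).const_mul 2).add (integrable_const _)) fun p ↦ ?_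
      change (φ p - c) ^ 2 ≤ 2 * (φ p - c') ^ 2 + 2 * (c - c') ^ 2
      nlinarith [sq_nonneg (φ p - c' + (c - c'))]
    rw [integral_add ((hi c' _).const_mul 2) (integrable_const _), integral_const_mul,
      setIntegral_const, smul_eq_mul] at h1
    linarith
  refine ⟨c, ?_⟩
  have hun : ∫ p in A ∪ A', (φ p - c) ^ 2 ∂(vol g) ≤
      ∫ p in A, (φ p - c) ^ 2 ∂(vol g) + ∫ p in A', (φ p - c) ^ 2 ∂(vol g) := by
    rw [← integral_add_measure (hi c _) (hi c _)]
    exact integral_mono_measure (Measure.restrict_union_le _ _)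
      (Eventually.of_forall fun p ↦ sq_nonneg _) ((hi c _).add_measure (hi c _))
  have h4 : (c - c') ^ 2 * b ≤ b * ((2 * C + 2 * C') / a) * dirichletForm g φ φ := by
    have h5 : (c - c') ^ 2 ≤ (2 * C + 2 * C') * dirichletForm g φ φ / a := by
      rwa [le_div_iff₀ ha0]
    calc (c - c') ^ 2 * b ≤ (2 * C + 2 * C') * dirichletForm g φ φ / a * b := by
          gcongr
      _ = _ := by ring
  linarith

/-- The Poincaré inequality on a compact connected manifold. -/
lemma hasPoincare_univ [ConnectedSpace M] (g : Metric n r M) : HasPoincare g Set.univ := by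
  obtain ⟨x₀⟩ : Nonempty M := inferInstance
  let P : Set M → Prop := fun s ↦ ∃ A, IsOpen A ∧ x₀ ∈ A ∧ s ⊆ A ∧ HasPoincare g A
  have hloc : ∀ x, ∃ U, IsOpen U ∧ x ∈ U ∧ HasPoincare g U := exists_local_poincare g
  -- The points joined to x₀ by an open set with a Poincaré inequality form a clopen set. Requiring
  -- x₀ in every A makes any two such sets overlap, as the compactness argument below needs.
  have hall : {x | P {x}} = Set.univ := by
    refine IsClopen.eq_univ ⟨?_, ?_⟩ ⟨x₀, ?_⟩
    · refine isClosed_of_closure_subset fun y hy ↦ ?_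
      obtain ⟨U, hU, hyU, hPU⟩ := hloc y
      obtain ⟨z, hzU, A, hA, hxA, hzA, hPA⟩ := mem_closure_iff.1 hy U hU hyU
      exact ⟨A ∪ U, hA.union hU, Or.inl hxA, by simp [hyU],
        hPA.union hA hU ⟨z, hzA rfl, hzU⟩ hPU⟩
    · refine isOpen_iff_forall_mem_open.2 fun y ⟨A, hA, hxA, hyA, hPA⟩ ↦ ?_
      exact ⟨A, fun z hz ↦ ⟨A, hA, hxA, by simpa using hz, hPA⟩, hA, hyA rfl⟩
    · obtain ⟨U, hU, hxU, hPU⟩ := hloc x₀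
      exact ⟨U, hU, hxU, by simpa using hxU, hPU⟩
  have huniv : P Set.univ := by
    refine isCompact_univ.induction_on (p := P) ?_ ?_ ?_ ?_
    · obtain ⟨U, hU, hxU, hPU⟩ := hloc x₀
      exact ⟨U, hU, hxU, Set.empty_subset _, hPU⟩
    · rintro s t hst ⟨A, hA, hxA, hyA, hPA⟩
      exact ⟨A, hA, hxA, hst.trans hyA, hPA⟩
    · rintro s t ⟨A, hA, hxA, hsA, hPA⟩ ⟨A', hA', hxA', htA', hPA'⟩
      exact ⟨A ∪ A', hA.union hA', Or.inl hxA, Set.union_subset_union hsA htA',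
        hPA.union hA hA' ⟨x₀, hxA, hxA'⟩ hPA'⟩
    · intro x _
      obtain ⟨A, hA, hxA, hyA, hPA⟩ : P {x} := hall.ge (Set.mem_univ x)
      exact ⟨A, mem_nhdsWithin_of_mem_nhds (hA.mem_nhds (hyA rfl)), A, hA, hxA, subset_rfl, hPA⟩
  obtain ⟨A, -, -, hA, hPA⟩ := huniv
  rwa [Set.univ_subset_iff.1 hA] at hPA

open scoped InnerProductSpace in
-- Bump functions at k distinct points with disjoint neighbourhoods; they are nonzero in L² because
-- the volume charges every nonempty open set.
lemma exists_orthogonal_smooth [T2Space M] [Nonempty M] (hn : 1 ≤ n) (g : Metric n r M) (k : ℕ) :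
    ∃ v : Fin k → C^∞⟮𝓡 n, M; ℝ⟯, (∀ i, toL2 (vol g) (v i) ≠ 0) ∧
      ∀ i l, i ≠ l → ⟪toL2 (vol g) (v i), toL2 (vol g) (v l)⟫_ℝ = 0 := by
  have hinf : Infinite M := infinite_of_pos hn
  let x : Fin k → M := fun i ↦ Infinite.natEmbedding M i
  have hx : Function.Injective x := fun i l h ↦
    Fin.ext ((Infinite.natEmbedding M).injective h)
  obtain ⟨U, hU, hdisj⟩ := (Set.finite_range x).t2_separation
  have hv : ∀ i, ∃ f : C^∞⟮𝓡 n, M; ℝ⟯, Set.EqOn f 0 (U (x i))ᶜ ∧ f (x i) = 1 := by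
    intro i
    obtain ⟨f, h0, h1, -⟩ := exists_contMDiffMap_zero_one_of_isClosed (𝓡 n) (n := (⊤ : ℕ∞))
      (hU (x i)).2.isClosed_compl (isClosed_singleton (x := x i))
      (by simpa using (hU (x i)).1)
    exact ⟨f, h0, h1 rfl⟩
  choose v hv0 hv1 using hv
  refine ⟨v, fun i h ↦ ?_, fun i l hil ↦ ?_⟩
  · have h1 : v i =ᵐ[vol g] (0 : M → ℝ) := by
      filter_upwards [coeFn_toL2 (vol g) (v i), Lp.coeFn_zero ℝ 2 (vol g)] with p hp hp'
      rw [← hp, h, hp']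
    have h2 := ((v i).contMDiff.continuous.ae_eq_iff_eq (vol g) continuous_zero).1 h1
    have h3 := congrFun h2 (x i)
    rw [hv1] at h3
    exact one_ne_zero h3
  · rw [inner_toL2]
    refine integral_eq_zero_of_ae ?_
    filter_upwards [coeFn_toL2 (vol g) (v i)] with p hp
    rw [hp]
    by_cases hpi : p ∈ U (x i)
    · have hpl : p ∉ U (x l) := fun h ↦
        Set.disjoint_left.1 (hdisj ⟨i, rfl⟩ ⟨l, rfl⟩ (hx.ne hil)) hpi h
      simp [hv0 l hpl]
    · simp [hv0 i hpi]

end Global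

/-! ### Comparison of two metrics: distances, diameters, eigenvalues. -/

section Comparison

variable {n : ℕ} {M : Type*} [TopologicalSpace M]
  [ChartedSpace (EuclideanSpace ℝ (Fin n)) M] [IsManifold (𝓡 n) ∞ M] {r : WithTop ℕ∞}

lemma pos_and_inner_le_of_rho_lt {g₀ g₁ : Metric n r M} {R : ℝ}
    (h : rho g₀ g₁ < ENNReal.ofReal R) :
    0 < R ∧ ∀ (x : M) (ξ : TangentSpace (𝓡 n) x),
      g₁.inner x ξ ξ ≤ Real.exp R * g₀.inner x ξ ξ ∧
      g₀.inner x ξ ξ ≤ Real.exp R * g₁.inner x ξ ξ := by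
  have hR : 0 < R := ENNReal.ofReal_pos.1 (bot_le.trans_lt h)
  refine ⟨hR, fun x ξ ↦ ?_⟩
  by_cases hξ : ξ = 0
  · simp [hξ]
  have h0 := g₀.pos x ξ hξ
  have h1 := g₁.pos x ξ hξ
  have h2 : ENNReal.ofReal |Real.log (g₁.inner x ξ ξ / g₀.inner x ξ ξ)| ≤ rho g₀ g₁ :=
    le_iSup_of_le x (le_iSup_of_le ξ (le_iSup_of_le hξ le_rfl))
  have h3 := abs_le.1 ((ENNReal.ofReal_le_ofReal_iff hR.le).1 (h2.trans h.le))
  rw [Real.log_div h1.ne' h0.ne'] at h3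
  constructor
  · rw [← Real.log_le_log_iff h1 (by positivity), Real.log_mul (Real.exp_pos R).ne' h0.ne',
      Real.log_exp]
    linarith
  · rw [← Real.log_le_log_iff h0 (by positivity), Real.log_mul (Real.exp_pos R).ne' h1.ne',
      Real.log_exp]
    linarith

/-- The Riemannian distance of a metric. -/
def riemannianDist (g : Metric n r M) (x y : M) : ℝ≥0∞ :=
  letI : Bundle.RiemannianBundle (fun x : M ↦ TangentSpace (𝓡 n) x) := ⟨g.toRiemannianMetric⟩
  Manifold.riemannianEDist (𝓡 n) x y

lemma diam_eq (g : Metric n r M) : diam g = (⨆ (x : M) (y : M), riemannianDist g x y).toReal := rfl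

/-- The norm of a tangent vector. -/
def tangentENorm (g : Metric n r M) {x : M} (v : TangentSpace (𝓡 n) x) : ℝ≥0∞ :=
  letI : Bundle.RiemannianBundle (fun x : M ↦ TangentSpace (𝓡 n) x) := ⟨g.toRiemannianMetric⟩
  ‖v‖ₑ

lemma tangentENorm_eq (g : Metric n r M) {x : M} (v : TangentSpace (𝓡 n) x) :
    tangentENorm g v = ENNReal.ofReal (√(g.inner x v v)) := by
  let : Bundle.RiemannianBundle (fun x : M ↦ TangentSpace (𝓡 n) x) := ⟨g.toRiemannianMetric⟩
  change ‖v‖ₑ = _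
  rw [← ofReal_norm, norm_eq_sqrt_real_inner]
  rfl

/-- Turns the metric from a local instance into an explicit argument, so that two metrics can be
integrated along the same path. -/
lemma riemannianDist_eq (g : Metric n r M) (x y : M) :
    riemannianDist g x y = ⨅ (γ : Path x y) (_ : ContMDiff (𝓡∂ 1) (𝓡 n) 1 γ),
      ∫⁻ t, tangentENorm g (mfderiv (𝓡∂ 1) (𝓡 n) γ t 1) := by
  let : Bundle.RiemannianBundle (fun x : M ↦ TangentSpace (𝓡 n) x) := ⟨g.toRiemannianMetric⟩
  change Manifold.riemannianEDist (𝓡 n) x y = _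
  rw [Manifold.riemannianEDist]
  rfl

lemma riemannianDist_le {g₀ g₁ : Metric n r M} {K : ℝ}
    (h : ∀ (x : M) (ξ : TangentSpace (𝓡 n) x), g₁.inner x ξ ξ ≤ K * g₀.inner x ξ ξ) (hK : 0 < K)
    (x y : M) :
    riemannianDist g₁ x y ≤ ENNReal.ofReal √K * riemannianDist g₀ x y := by
  have h1 : ∀ (x : M) (ξ : TangentSpace (𝓡 n) x),
      tangentENorm g₁ ξ ≤ ENNReal.ofReal √K * tangentENorm g₀ ξ := by
    intro x ξ
    rw [tangentENorm_eq, tangentENorm_eq, ← ENNReal.ofReal_mul (Real.sqrt_nonneg _),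
      ← Real.sqrt_mul hK.le]
    exact ENNReal.ofReal_le_ofReal (Real.sqrt_le_sqrt (h x ξ))
  rw [riemannianDist_eq, riemannianDist_eq]
  have hK' : ENNReal.ofReal √K ≠ 0 := (ENNReal.ofReal_pos.2 (Real.sqrt_pos.2 hK)).ne'
  simp only [ENNReal.mul_iInf_of_ne hK' ENNReal.ofReal_ne_top]
  refine iInf₂_mono fun γ _ ↦ ?_
  rw [← lintegral_const_mul' _ _ ENNReal.ofReal_ne_top]
  exact lintegral_mono fun t ↦ h1 _ _

/-- The Riemannian distance is an extended metric inducing the topology of M. Points at finite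
distance from x form a clopen set, hence all of M, and the continuous distance attains its maximum
on the compact M × M. Finiteness matters because `diam` is a `toReal`, which sends ⊤ to 0. -/
lemma iSup_riemannianDist [CompactSpace M] [T2Space M] [ConnectedSpace M] (hn : 1 ≤ n)
    (g : Metric n r M) :
    0 < (⨆ (x : M) (y : M), riemannianDist g x y) ∧ (⨆ (x : M) (y : M), riemannianDist g x y) ≠ ⊤ := by
  let : Bundle.RiemannianBundle (fun x : M ↦ TangentSpace (𝓡 n) x) := ⟨g.toRiemannianMetric⟩
  have : IsManifold (𝓡 n) 1 M := IsManifold.of_le (n := ∞) (by simp)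
  have : IsContinuousRiemannianBundle (EuclideanSpace ℝ (Fin n))
      (fun x : M ↦ TangentSpace (𝓡 n) x) :=
    ⟨g.inner, g.contMDiff.continuous, fun _ _ _ ↦ rfl⟩
  let : EMetricSpace M := EMetricSpace.ofRiemannianMetric (𝓡 n) M
  have he : ∀ x y : M, riemannianDist g x y = edist x y := fun x y ↦ rfl
  simp only [he]
  have : Infinite M := infinite_of_pos hn
  constructor
  · obtain ⟨x, y, hxy⟩ := exists_pair_ne M
    exact (edist_pos.2 hxy).trans_le (le_iSup_of_le x (le_iSup_of_le y le_rfl))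
  · obtain ⟨x, -⟩ := exists_pair_ne M
    have hball : Metric.eball x ⊤ = Set.univ :=
      IsClopen.eq_univ ⟨Metric.isClosed_eball_top, Metric.isOpen_eball⟩
        ⟨x, Metric.mem_eball_self (by simp)⟩
    have hfin : ∀ y z : M, edist y z ≠ ⊤ := fun y z ↦ by
      have hy : edist y x < ⊤ := hball.ge (Set.mem_univ y)
      have hz : edist z x < ⊤ := hball.ge (Set.mem_univ z)
      exact ((edist_triangle_right y z x).trans_lt (ENNReal.add_lt_top.2 ⟨hy, hz⟩)).ne
    obtain ⟨p, -, hp⟩ := isCompact_univ.exists_isMaxOn (s := (Set.univ : Set (M × M)))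
      ⟨(x, x), trivial⟩ (f := fun p : M × M ↦ edist p.1 p.2) (by fun_prop)
    exact ((iSup₂_le fun y z ↦ hp (Set.mem_univ (y, z))).trans_lt (hfin p.1 p.2).lt_top).ne

lemma diam_pos [CompactSpace M] [T2Space M] [ConnectedSpace M] (hn : 1 ≤ n) (g : Metric n r M) :
    0 < diam g := by
  obtain ⟨h0, h1⟩ := iSup_riemannianDist hn g
  exact ENNReal.toReal_pos h0.ne' h1

lemma diam_le [CompactSpace M] [T2Space M] [ConnectedSpace M] (hn : 1 ≤ n)
    {g₀ g₁ : Metric n r M} {K : ℝ}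
    (h : ∀ (x : M) (ξ : TangentSpace (𝓡 n) x), g₁.inner x ξ ξ ≤ K * g₀.inner x ξ ξ)
    (hK : 0 < K) : diam g₁ ≤ √K * diam g₀ := by
  rw [diam_eq, diam_eq, ← ENNReal.toReal_ofReal (Real.sqrt_nonneg K), ← ENNReal.toReal_mul]
  refine ENNReal.toReal_mono
    (ENNReal.mul_ne_top ENNReal.ofReal_ne_top (iSup_riemannianDist hn g₀).2) ?_
  exact iSup₂_le fun x y ↦ (riemannianDist_le h hK x y).trans
    (mul_le_mul_right (le_iSup₂ (f := fun x y ↦ riemannianDist g₀ x y) x y) _)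

section Eigenvalues

variable [CompactSpace M] [MeasurableSpace M] [BorelSpace M]

/-- The type of L² functions depends on the measure; moving to a common m puts the forms of both
metrics over one Hilbert space. -/
lemma eigenvalue_eq_of_vol_eq (g : Metric n r M) {m : Measure M} [IsFiniteMeasure m]
    (hm : vol g = m) (k : ℕ) :
    eigenvalue g k = sInf {t | HasEigenvectors (toL2 m) (dirichletForm g) k t} := by
  subst hm
  exact eigenvalue_eq g k

lemma isCompactForm_of_vol_eq (g : Metric n r M) {m : Measure M} [IsFiniteMeasure m]
    (hm : vol g = m) : IsCompactForm (toL2 m) (dirichletForm g) := by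
  subst hm
  exact isCompactForm_dirichletForm g

lemma dirichletForm_le {g₀ g₁ : Metric n r M} (hvol : vol g₀ = vol g₁) {K : ℝ}
    (h : ∀ (x : M) (ξ : TangentSpace (𝓡 n) x), g₁.inner x ξ ξ ≤ K * g₀.inner x ξ ξ)
    (φ : C^∞⟮𝓡 n, M; ℝ⟯) : dirichletForm g₀ φ φ ≤ K * dirichletForm g₁ φ φ := by
  rw [dirichletForm_apply, dirichletForm_apply, dirichlet, dirichlet, ← hvol,
    ← integral_const_mul]
  refine integral_mono (integrable_of_continuous (continuous_cometric_mfderiv g₀ φ φ))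
    ((integrable_of_continuous (continuous_cometric_mfderiv g₁ φ φ)).const_mul K) fun x ↦ ?_
  exact cometric_le_of_inner_le (h x) _

lemma eigenvalue_nonneg (g : Metric n r M) (k : ℕ) : 0 ≤ eigenvalue g k := by
  rw [eigenvalue_eq]
  exact Real.sInf_nonneg fun t ht ↦ ht.nonneg (dirichletForm_symm g) (dirichletForm_nonneg g)

lemma hasEigenvectors_of_inner_le {g₀ g₁ : Metric n r M} {m : Measure M} [IsFiniteMeasure m]
    (h₀ : vol g₀ = m) (h₁ : vol g₁ = m) {K : ℝ} (hK : 0 < K)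
    (h : ∀ (x : M) (ξ : TangentSpace (𝓡 n) x), g₁.inner x ξ ξ ≤ K * g₀.inner x ξ ξ)
    {k : ℕ} {t : ℝ} (ht : HasEigenvectors (toL2 m) (dirichletForm g₁) k t) :
    HasEigenvectors (toL2 m) (dirichletForm g₀) k (K * t) :=
  ht.of_le (dirichletForm_symm g₁) (dirichletForm_nonneg g₁) (dirichletForm_symm g₀)
    (dirichletForm_nonneg g₀) (isCompactForm_of_vol_eq g₀ h₀) hK
    (dirichletForm_le (h₀.trans h₁.symm) h)

lemma eigenvalue_le {g₀ g₁ : Metric n r M} (hvol : vol g₀ = vol g₁) {K : ℝ} (hK : 0 < K)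
    (h : ∀ (x : M) (ξ : TangentSpace (𝓡 n) x), g₁.inner x ξ ξ ≤ K * g₀.inner x ξ ξ ∧
      g₀.inner x ξ ξ ≤ K * g₁.inner x ξ ξ) (k : ℕ) :
    eigenvalue g₀ k ≤ K * eigenvalue g₁ k := by
  rw [eigenvalue_eq_of_vol_eq g₀ hvol, eigenvalue_eq g₁]
  set S₀ := {t | HasEigenvectors (toL2 (vol g₁)) (dirichletForm g₀) k t}
  set S₁ := {t | HasEigenvectors (toL2 (vol g₁)) (dirichletForm g₁) k t}
  have h01 : ∀ t ∈ S₁, K * t ∈ S₀ := fun t ht ↦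
    hasEigenvectors_of_inner_le hvol rfl hK (fun x ξ ↦ (h x ξ).1) ht
  -- Needed only for the convention sInf ∅ = 0: S₀ and S₁ are empty together, as happens for
  -- instance when M is empty.
  have h10 : ∀ t ∈ S₀, K * t ∈ S₁ := fun t ht ↦
    hasEigenvectors_of_inner_le rfl hvol hK (fun x ξ ↦ (h x ξ).2) ht
  have hb : BddBelow S₀ := ⟨0, fun t ht ↦
    ht.nonneg (dirichletForm_symm g₀) (dirichletForm_nonneg g₀)⟩
  rcases S₁.eq_empty_or_nonempty with he | hne
  · have he' : S₀ = ∅ := Set.eq_empty_of_forall_notMem fun t ht ↦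
      Set.notMem_empty _ (he.le (h10 t ht))
    simp [he, he']
  · rw [← div_le_iff₀' hK]
    refine le_csInf hne fun t ht ↦ ?_
    rw [div_le_iff₀' hK]
    exact csInf_le hb (h01 t ht)

lemma eigenvalue_pos [T2Space M] [ConnectedSpace M] (hn : 1 ≤ n) (g : Metric n r M) {k : ℕ}
    (hk : 1 ≤ k) : 0 < eigenvalue g k := by
  obtain ⟨v, hv0, hv⟩ := exists_orthogonal_smooth hn g (k + 1)
  obtain ⟨C, hC⟩ := hasPoincare_univ g
  have hC0 : 0 < max C 1 := lt_max_of_lt_right one_pos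
  rw [eigenvalue_eq]
  -- A lower bound on the set does not suffice, since the infimum of the empty set is 0; the k + 1
  -- orthogonal functions show that it is nonempty.
  refine (one_div_pos.2 hC0).trans_le (le_csInf
    (exists_hasEigenvectors (dirichletForm_symm g) (dirichletForm_nonneg g)
      (isCompactForm_dirichletForm g) v hv0 hv) fun t ht ↦ ?_)
  refine ht.le_of_poincare (w := toL2 (vol g) (1 : C^∞⟮𝓡 n, M; ℝ⟯)) (dirichletForm_symm g) (dirichletForm_nonneg g)
    hC0 (fun φ ↦ ?_) hk
  obtain ⟨c, hc⟩ := hC φ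
  refine ⟨c, ?_⟩
  rw [norm_toL2_sub_sq]
  rw [setIntegral_univ] at hc
  exact hc.trans (mul_le_mul_of_nonneg_right (le_max_left _ _) (dirichletForm_nonneg g φ))

end Eigenvalues

end Comparison

end RandomMetrics

end

theorem mainTheorem6 {n : ℕ} (hn : 1 ≤ n) {M : Type*} [TopologicalSpace M] [T2Space M]
    [CompactSpace M] [MeasurableSpace M] [BorelSpace M]
    [ChartedSpace (EuclideanSpace ℝ (Fin n)) M] [IsManifold (𝓡 n) ∞ M]
    {r : WithTop ℕ∞} (g₀ g₁ : RandomMetrics.Metric n r M) (R : ℝ)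
    (hvol : RandomMetrics.vol g₀ = RandomMetrics.vol g₁)
    (hρ : RandomMetrics.rho g₀ g₁ < ENNReal.ofReal R) :
    (ConnectedSpace M →
      Real.exp (-R) ≤ RandomMetrics.diam g₁ / RandomMetrics.diam g₀ ∧
      RandomMetrics.diam g₁ / RandomMetrics.diam g₀ ≤ Real.exp R) ∧
    (∀ k : ℕ,
      Real.exp (-2 * R) * RandomMetrics.eigenvalue g₀ k ≤ RandomMetrics.eigenvalue g₁ k ∧
      RandomMetrics.eigenvalue g₁ k ≤ Real.exp (2 * R) * RandomMetrics.eigenvalue g₀ k) ∧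
    (ConnectedSpace M → ∀ k : ℕ, 1 ≤ k →
      Real.exp (-2 * R) ≤ RandomMetrics.eigenvalue g₁ k / RandomMetrics.eigenvalue g₀ k ∧
      RandomMetrics.eigenvalue g₁ k / RandomMetrics.eigenvalue g₀ k ≤ Real.exp (2 * R)) := by
  obtain ⟨hR, h⟩ := RandomMetrics.pos_and_inner_le_of_rho_lt hρ
  have hK := Real.exp_pos R
  have hKK : Real.exp (2 * R) = Real.exp R * Real.exp R := by rw [← Real.exp_add]; ring_nf
  have h1K : 1 ≤ Real.exp R := Real.one_le_exp hR.le
  have hneg : Real.exp (-2 * R) = (Real.exp (2 * R))⁻¹ := by rw [← Real.exp_neg]; ring_nf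
  have hev : ∀ k : ℕ,
      Real.exp (-2 * R) * RandomMetrics.eigenvalue g₀ k ≤ RandomMetrics.eigenvalue g₁ k ∧
      RandomMetrics.eigenvalue g₁ k ≤ Real.exp (2 * R) * RandomMetrics.eigenvalue g₀ k := by
    intro k
    have h01 := RandomMetrics.eigenvalue_le hvol hK h k
    have h10 := RandomMetrics.eigenvalue_le hvol.symm hK (fun x ξ ↦ (h x ξ).symm) k
    have hn0 := RandomMetrics.eigenvalue_nonneg g₀ k
    have hn1 := RandomMetrics.eigenvalue_nonneg g₁ k
    -- The comparison already holds with e^{R}; since the eigenvalues are nonnegative and R > 0, it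
    -- may be relaxed to e^{2R}.
    have hle : Real.exp R ≤ Real.exp (2 * R) := Real.exp_le_exp.2 (by linarith)
    rw [hneg, inv_mul_le_iff₀ (Real.exp_pos _)]
    exact ⟨h01.trans (mul_le_mul_of_nonneg_right hle hn1),
      h10.trans (mul_le_mul_of_nonneg_right hle hn0)⟩
  refine ⟨fun _ ↦ ?_, hev, fun _ k hk ↦ ?_⟩
  · have hd0 := RandomMetrics.diam_pos hn g₀
    have hd1 := RandomMetrics.diam_pos hn g₁
    have h01 := RandomMetrics.diam_le hn (fun x ξ ↦ (h x ξ).1) hK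
    have h10 := RandomMetrics.diam_le hn (fun x ξ ↦ (h x ξ).2) hK
    have hsqrt : √(Real.exp R) ≤ Real.exp R := Real.sqrt_le_iff.2 ⟨hK.le, le_self_pow₀ h1K two_ne_zero⟩
    rw [le_div_iff₀ hd0, div_le_iff₀ hd0, Real.exp_neg, inv_mul_le_iff₀ hK]
    exact ⟨h10.trans (mul_le_mul_of_nonneg_right hsqrt hd1.le),
      h01.trans (mul_le_mul_of_nonneg_right hsqrt hd0.le)⟩
  · have hp := RandomMetrics.eigenvalue_pos hn g₀ hk
    rw [le_div_iff₀ hp, div_le_iff₀ hp]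
    exact hev k
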